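/- The machine model is the word RAM with words of $O(\log N)$ bits on inputs of size $N$ and unit-cost operations; algorithms are deterministic. \emph{Partial 2-Dominating Set}: given a graph $G=(V,E)$ by a list of its edges, with $n=|V|\ge 1$ vertices and $m=|E|\ge n$ edges, compute $$\max_{x_1,x_2\in V}\bigl|N[x_1]\cup N[x_2]\bigr|,$$ the largest number of vertices that can be dominated by two vertices, where $N[v]=\{v\}\cup\{u : \{u,v\}\in E\}$. \emph{Orthogonal Vectors} (OV): given two families $A_1,A_2$ of $n\ge 1$ vectors in $\{0,1\}^d$, decide whether there are $a_1\in A_1$, $a_2\in A_2$ with $\sum_{y=1}^d a_1[y]\,a_2[y]=0$. \emph{OV Hypothesis}: for no $\varepsilon>0$ and no function $D:\mathbb{N}\to\mathbb{N}$ with $D(n)=\omega(\log n)$ is there an algorithm that solves all OV instances with $d\le D(n)$ in time $O(n^{2-\varepsilon})$. \textbf{Theorem.} Let $\varepsilon>0$. If there exists an algorithm solving Partial 2-Dominating Set in time $O(m^{4/3-\varepsilon})$, then the OV Hypothesis is false. -/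

import Mathlib

/-! ## The word RAM

The machine has registers and a random access memory, both indexed by `ℕ`, holding natural
numbers.  Every operation takes one step.  A run is legal only if every number that it produces
fits into a machine word of `O(log N)` bits, `N` being the size of the input; see `Exec` and
`Cmd.OutputsWithin`.  Programs are written in structured form (sequencing, branching, loops);
compared with jumps this changes the number of steps by at most a constant factor that depends
only on the program. -/

namespace WordRAM

/-- The operations of the arithmetic unit. -/
inductive BinOp where
  | add | sub | mul | div | mod | and | or | xor | shl | shr | lt | eq

/-- Subtraction is truncated at `0`, `a / 0 = 0`, `a % 0 = a`, and comparisons return `0` or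
`1`. -/
def BinOp.eval : BinOp → ℕ → ℕ → ℕ
  | .add, a, b => a + b
  | .sub, a, b => a - b
  | .mul, a, b => a * b
  | .div, a, b => a / b
  | .mod, a, b => a % b
  | .and, a, b => a &&& b
  | .or, a, b => a ||| b
  | .xor, a, b => a ^^^ b
  | .shl, a, b => a <<< b
  | .shr, a, b => a >>> b
  | .lt, a, b => if a < b then 1 else 0
  | .eq, a, b => if a = b then 1 else 0

/-- Programs.  The natural number arguments `r`, `a`, `b` are names of registers. -/
inductive Cmd where
  /-- do nothing -/
  | skip
  /-- `r := k` -/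
  | const (r k : ℕ)
  /-- `r := f a b` -/
  | op (f : BinOp) (r a b : ℕ)
  /-- `r := mem[a]` (indirect addressing) -/
  | load (r a : ℕ)
  /-- `mem[a] := b` (indirect addressing) -/
  | store (a b : ℕ)
  /-- `P ; Q` -/
  | seq (P Q : Cmd)
  /-- if `r ≠ 0` then `P` else `Q` -/
  | cond (r : ℕ) (P Q : Cmd)
  /-- while `r ≠ 0` do `P` -/
  | loop (r : ℕ) (P : Cmd)

/-- A configuration: the contents of the registers and of the memory. -/
structure State where
  reg : ℕ → ℕ
  mem : ℕ → ℕ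

/-- Write `v` into register `r`. -/
def State.setReg (s : State) (r v : ℕ) : State :=
  { s with reg := Function.update s.reg r v }

/-- Write `v` into the memory cell with address `i`. -/
def State.setMem (s : State) (i v : ℕ) : State :=
  { s with mem := Function.update s.mem i v }

/-- `Exec W P s s' t`: started in `s`, the program `P` halts in `s'` after exactly `t` steps, and
every number written into a register by a constant or by the arithmetic unit is less than `W`
(if some number does not fit, there is no legal run). -/
inductive Exec (W : ℕ) : Cmd → State → State → ℕ → Prop
  | skip (s : State) : Exec W .skip s s 1
  | const (s : State) (r k : ℕ) (h : k < W) : Exec W (.const r k) s (s.setReg r k) 1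
  | op (s : State) (f : BinOp) (r a b : ℕ) (h : f.eval (s.reg a) (s.reg b) < W) :
      Exec W (.op f r a b) s (s.setReg r (f.eval (s.reg a) (s.reg b))) 1
  | load (s : State) (r a : ℕ) : Exec W (.load r a) s (s.setReg r (s.mem (s.reg a))) 1
  | store (s : State) (a b : ℕ) : Exec W (.store a b) s (s.setMem (s.reg a) (s.reg b)) 1
  | seq (P Q : Cmd) (s₁ s₂ s₃ : State) (t₁ t₂ : ℕ) (h₁ : Exec W P s₁ s₂ t₁)
      (h₂ : Exec W Q s₂ s₃ t₂) : Exec W (.seq P Q) s₁ s₃ (t₁ + t₂)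
  | condTrue (r : ℕ) (P Q : Cmd) (s s' : State) (t : ℕ) (hr : s.reg r ≠ 0)
      (h : Exec W P s s' t) : Exec W (.cond r P Q) s s' (t + 1)
  | condFalse (r : ℕ) (P Q : Cmd) (s s' : State) (t : ℕ) (hr : s.reg r = 0)
      (h : Exec W Q s s' t) : Exec W (.cond r P Q) s s' (t + 1)
  | loopDone (r : ℕ) (P : Cmd) (s : State) (hr : s.reg r = 0) : Exec W (.loop r P) s s 1
  | loopStep (r : ℕ) (P : Cmd) (s₁ s₂ s₃ : State) (t₁ t₂ : ℕ) (hr : s₁.reg r ≠ 0)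
      (h₁ : Exec W P s₁ s₂ t₁) (h₂ : Exec W (.loop r P) s₂ s₃ t₂) :
      Exec W (.loop r P) s₁ s₃ (t₁ + t₂ + 1)

/-- The initial configuration: the input is in the memory cells `0, 1, 2, …`, and everything else
is `0`. -/
def initState (x : List ℕ) : State where
  reg := fun _ => 0
  mem := fun i => x.getD i 0

/-- The size of an input, as far as the word length is concerned: the number of its words plus the
largest of them (plus `2`, so that it is at least `2`). -/
def inputSize (x : List ℕ) : ℕ := x.length + x.foldr max 0 + 2

/-- With words for the numbers below `N ^ c`, i.e. of `c log₂ N` bits, where `N` is the size of the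
input `x`, the program `P` halts on `x` after at most `T` steps, with `y` in register `0`. -/
def Cmd.OutputsWithin (P : Cmd) (c : ℕ) (x : List ℕ) (y : ℕ) (T : ℝ) : Prop :=
  ∃ (s : State) (t : ℕ),
    Exec (inputSize x ^ c) P (initState x) s t ∧ s.reg 0 = y ∧ (t : ℝ) ≤ T

end WordRAM

/-! ## Partial 2-Dominating Set -/

namespace PartialDom

/-- `E` lists every edge of `G` exactly once, in an arbitrary order and orientation. -/
def IsEdgeList {n : ℕ} (G : SimpleGraph (Fin n)) (E : List (Fin n × Fin n)) : Prop :=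
  (E.map fun e => s(e.1, e.2)).Nodup ∧
    ∀ e : Sym2 (Fin n), e ∈ E.map (fun e => s(e.1, e.2)) ↔ e ∈ G.edgeSet

/-- A graph on `{0, …, n - 1}` as a list of words: `n`, `m`, and then the two ends of each of the
`m` edges. -/
def encode {n : ℕ} (E : List (Fin n × Fin n)) : List ℕ :=
  n :: E.length :: E.flatMap fun e => [(e.1 : ℕ), (e.2 : ℕ)]

/-- The closed neighborhood `N[v]`, the set of the vertices that `v` dominates. -/
def closedNbhd {V : Type*} (G : SimpleGraph V) (v : V) : Set V :=
  insert v (G.neighborSet v)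

/-- `t` is the largest number of vertices that can be dominated by two vertices. -/
def IsOptimum {V : Type*} (G : SimpleGraph V) (t : ℕ) : Prop :=
  IsGreatest {k : ℕ | ∃ x₁ x₂ : V, k = (closedNbhd G x₁ ∪ closedNbhd G x₂).ncard} t

/-- The program `P` solves Partial 2-Dominating Set in time `T(m)`: on every nonempty graph with
`n` vertices and `m ≥ n` edges, given by a list of its edges, it computes the optimum in at most
`T(m)` steps, on words of `O(log m)` bits. -/
def Solves (P : WordRAM.Cmd) (T : ℕ → ℝ) : Prop :=
  ∃ c : ℕ, ∀ (n : ℕ) (G : SimpleGraph (Fin n)) (E : List (Fin n × Fin n)) (t : ℕ),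
    1 ≤ n → n ≤ G.edgeSet.ncard → IsEdgeList G E → IsOptimum G t →
      P.OutputsWithin c (encode E) t (T G.edgeSet.ncard)

end PartialDom

/-! ## Orthogonal Vectors -/

namespace OV

/-- `n` binary vectors of dimension `d`, row by row, one word for each entry. -/
def encodeVectors {n d : ℕ} (A : Fin n → Fin d → Bool) : List ℕ :=
  (List.ofFn fun i => List.ofFn fun y => (A i y).toNat).flatten

/-- An instance as a list of words: `n`, `d`, and then the two families of vectors. -/
def encode {n d : ℕ} (A B : Fin n → Fin d → Bool) : List ℕ :=
  n :: d :: (encodeVectors A ++ encodeVectors B)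

/-- Some vector of `A` is orthogonal to some vector of `B`. -/
def HasOrthogonalPair {n d : ℕ} (A B : Fin n → Fin d → Bool) : Prop :=
  ∃ i j, ∑ y, (A i y).toNat * (B j y).toNat = 0

open Classical in
/-- The program `P` solves Orthogonal Vectors in dimensions up to `D(n)` in time `T(n)`: on all
families of `n ≥ 1` vectors of dimension `d ≤ D(n)` it decides in at most `T(n)` steps, on words of
`O(log (n + d))` bits, whether there is an orthogonal pair (answer `1` for yes, `0` for no). -/
def Solves (P : WordRAM.Cmd) (D : ℕ → ℕ) (T : ℕ → ℝ) : Prop :=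
  ∃ c : ℕ, ∀ (n d : ℕ) (A B : Fin n → Fin d → Bool), 1 ≤ n → d ≤ D n →
    P.OutputsWithin c (encode A B) (if HasOrthogonalPair A B then 1 else 0) (T n)

/-- The OV Hypothesis: for no `ε > 0` is there an algorithm that solves Orthogonal Vectors in time
`O(n ^ (2 - ε))` in a regime of dimensions `D(n) = ω(log n)`. -/
def Hypothesis : Prop :=
  ¬ ∃ (ε : ℝ) (D : ℕ → ℕ), 0 < ε ∧
    (fun n : ℕ => Real.log n) =o[Filter.atTop] (fun n : ℕ => (D n : ℝ)) ∧
    ∃ (P : WordRAM.Cmd) (C : ℝ), Solves P D fun n => C * (n : ℝ) ^ (2 - ε)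

end OV

/-! Put both families of vectors into one list, pad it by repetition to `s²` vectors with `s ≈
√(2n)`, and cut it into `s` groups of size `s`. Append three coordinates that give any two vectors
of the same family a common `1` and any two vectors of different families none. Then orthogonal
pairs of the instance correspond to pairs of the list without a common `1`. With `D = d + 3`, build
a bipartite graph: every vector `x` of group `g` gets one neighbor for each group `h` and each
coordinate `y`. If `x` has a `1` at `y`, this neighbor depends only on `y` and the unordered pair
`{g, h}`, so vectors of groups `g` and `h` with a `1` at `y` meet there. If `x` has a `0`, it
depends on `y`, the ordered pair `(g, h)` and the family of `x`, so only members of one family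
collide, and these are never orthogonal anyway (`gadget_inj`, `gadget_symm`).

Thus each vector dominates exactly `s D + 1` vertices, and two closed neighborhoods are disjoint
exactly when there is no common `1`. Every other vertex has at most `2 s` neighbors and dominates
fewer vertices because `D ≥ 3`. So the optimum is `2 (s D + 1)` if and only if an orthogonal pair
exists (`gadgetGraph_optimum`, `hasOrthogonalPair_iff`).

Grouping keeps the graph small: it has `m = s³ D = O(n^(3/2) d)` edges, and `m^(4/3)` is about `n²`
when `d` is `n^o(1)`. The dimension bound `log² n` is `ω(log n)` but below every power of `n`, so a
saving in the exponent for the graph problem gives one for Orthogonal Vectors. The rest implements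
the reduction on the word RAM in `O(m)` steps and with words of proportional length;
`reduction_outputsWithin` joins it to the given program. -/

namespace WordRAM

/-! ### Reasoning about runs of structured programs -/

@[simp] theorem State.reg_setReg (s : State) (r v r' : ℕ) :
    (s.setReg r v).reg r' = if r' = r then v else s.reg r' := by
  simp [State.setReg, Function.update_apply]

@[simp] theorem State.mem_setReg (s : State) (r v : ℕ) : (s.setReg r v).mem = s.mem := rfl

@[simp] theorem State.reg_setMem (s : State) (i v : ℕ) : (s.setMem i v).reg = s.reg := rfl

@[simp] theorem State.mem_setMem (s : State) (i v j : ℕ) :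
    (s.setMem i v).mem j = if j = i then v else s.mem j := by
  simp [State.setMem, Function.update_apply]

/-- Lets the given program, whose word length is tied to the constructed graph, run inside the
reduction, where words are longer. -/
theorem Exec.mono {W W' : ℕ} (hW : W ≤ W') {P : Cmd} {s s' : State} {t : ℕ}
    (h : Exec W P s s' t) : Exec W' P s s' t := by
  induction h with
  | skip s => exact .skip s
  | const s r k h => exact .const s r k (h.trans_le hW)
  | op s f r a b h => exact .op s f r a b (h.trans_le hW)
  | load s r a => exact .load s r a
  | store s a b => exact .store s a b
  | seq P Q s₁ s₂ s₃ t₁ t₂ _ _ ih₁ ih₂ => exact .seq P Q s₁ s₂ s₃ t₁ t₂ ih₁ ih₂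
  | condTrue r P Q s s' t hr _ ih => exact .condTrue r P Q s s' t hr ih
  | condFalse r P Q s s' t hr _ ih => exact .condFalse r P Q s s' t hr ih
  | loopDone r P s hr => exact .loopDone r P s hr
  | loopStep r P s₁ s₂ s₃ t₁ t₂ hr _ _ ih₁ ih₂ =>
    exact .loopStep r P s₁ s₂ s₃ t₁ t₂ hr ih₁ ih₂

/-- A strict upper bound for the registers that occur in a program. -/
def Cmd.regBound : Cmd → ℕ
  | .skip => 0
  | .const r _ => r + 1
  | .op _ r a b => r + a + b + 1
  | .load r a => r + a + 1
  | .store a b => a + b + 1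
  | .seq P Q => P.regBound + Q.regBound
  | .cond r P Q => r + 1 + P.regBound + Q.regBound
  | .loop r P => r + 1 + P.regBound

/-- The two states have the same memory and the same registers below `B`. -/
def AgreeBelow (B : ℕ) (s u : State) : Prop := (∀ r < B, u.reg r = s.reg r) ∧ u.mem = s.mem

theorem AgreeBelow.setReg {B : ℕ} {s u : State} (h : AgreeBelow B s u) (r v : ℕ) :
    AgreeBelow B (s.setReg r v) (u.setReg r v) := by
  refine ⟨fun r' hr' => ?_, h.2⟩
  simp [h.1 r' hr']

/-- A program neither reads nor writes the registers that do not occur in it. -/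
theorem Exec.frame {W B : ℕ} {P : Cmd} {s s' : State} {t : ℕ} (h : Exec W P s s' t)
    (hB : P.regBound ≤ B) (u : State) (hu : AgreeBelow B s u) :
    ∃ u', Exec W P u u' t ∧ AgreeBelow B s' u' ∧ ∀ r, B ≤ r → u'.reg r = u.reg r := by
  induction h generalizing u with
  | skip s => exact ⟨u, .skip u, hu, fun _ _ => rfl⟩
  | const s r k h =>
    simp only [Cmd.regBound] at hB
    refine ⟨_, .const u r k h, hu.setReg r k, fun r' hr' => ?_⟩
    rw [State.reg_setReg, if_neg (by omega)]
  | op s f r a b h =>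
    simp only [Cmd.regBound] at hB
    rw [← hu.1 a (by omega), ← hu.1 b (by omega)] at h ⊢
    refine ⟨_, .op u f r a b h, hu.setReg r _, fun r' hr' => ?_⟩
    rw [State.reg_setReg, if_neg (by omega)]
  | load s r a =>
    simp only [Cmd.regBound] at hB
    rw [← hu.1 a (by omega), ← hu.2]
    refine ⟨_, .load u r a, hu.setReg r _, fun r' hr' => ?_⟩
    rw [State.reg_setReg, if_neg (by omega)]
  | store s a b =>
    simp only [Cmd.regBound] at hB
    refine ⟨_, .store u a b, ⟨fun r' hr' => hu.1 r' hr', ?_⟩, fun r' hr' => rfl⟩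
    simp only [State.setMem, hu.1 a (by omega), hu.1 b (by omega), hu.2]
  | seq P Q s₁ s₂ s₃ t₁ t₂ _ _ ih₁ ih₂ =>
    simp only [Cmd.regBound] at hB
    obtain ⟨u₂, e₂, a₂, f₂⟩ := ih₁ (by omega) u hu
    obtain ⟨u₃, e₃, a₃, f₃⟩ := ih₂ (by omega) u₂ a₂
    exact ⟨u₃, .seq P Q u u₂ u₃ t₁ t₂ e₂ e₃, a₃, fun r hr => (f₃ r hr).trans (f₂ r hr)⟩
  | condTrue r P Q s s' t hr _ ih =>
    simp only [Cmd.regBound] at hB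
    obtain ⟨u₂, e₂, a₂, f₂⟩ := ih (by omega) u hu
    exact ⟨u₂, .condTrue r P Q u u₂ t (by rwa [hu.1 r (by omega)]) e₂, a₂, f₂⟩
  | condFalse r P Q s s' t hr _ ih =>
    simp only [Cmd.regBound] at hB
    obtain ⟨u₂, e₂, a₂, f₂⟩ := ih (by omega) u hu
    exact ⟨u₂, .condFalse r P Q u u₂ t (by rwa [hu.1 r (by omega)]) e₂, a₂, f₂⟩
  | loopDone r P s hr =>
    simp only [Cmd.regBound] at hB
    exact ⟨u, .loopDone r P u (by rwa [hu.1 r (by omega)]), hu, fun _ _ => rfl⟩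
  | loopStep r P s₁ s₂ s₃ t₁ t₂ hr _ _ ih₁ ih₂ =>
    simp only [Cmd.regBound] at hB ih₂
    obtain ⟨u₂, e₂, a₂, f₂⟩ := ih₁ (by omega) u hu
    obtain ⟨u₃, e₃, a₃, f₃⟩ := ih₂ (by omega) u₂ a₂
    exact ⟨u₃, .loopStep r P u u₂ u₃ t₁ t₂ (by rwa [hu.1 r (by omega)]) e₂ e₃, a₃,
      fun r hr => (f₃ r hr).trans (f₂ r hr)⟩

/-- Started in `s`, the program `P` halts legally after at most `T` steps, in a state that
satisfies `Q`. -/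
def Reaches (W : ℕ) (P : Cmd) (s : State) (T : ℕ) (Q : State → Prop) : Prop :=
  ∃ s' t, Exec W P s s' t ∧ t ≤ T ∧ Q s'

/-- Execute a list of programs one after the other. -/
def Cmd.block : List Cmd → Cmd
  | [] => .skip
  | P :: l => .seq P (Cmd.block l)

namespace Reaches

variable {W : ℕ} {s : State} {Q : State → Prop} {T : ℕ} {l : List Cmd}

theorem weaken {P : Cmd} {T' : ℕ} {Q' : State → Prop} (h : Reaches W P s T Q) (hT : T ≤ T')
    (hQ : ∀ s', Q s' → Q' s') : Reaches W P s T' Q' := by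
  obtain ⟨s', t, e, ht, q⟩ := h
  exact ⟨s', t, e, ht.trans hT, hQ _ q⟩

theorem nil (h : Q s) : Reaches W (.block []) s 1 Q := ⟨s, 1, .skip s, le_rfl, h⟩

/-- The bound for the tail stands first, so the explicit step counts below read from the last
instruction back to the first, with a leading `1` for the closing `skip`. -/
theorem cons {P : Cmd} {T' : ℕ} (h : Reaches W P s T fun s' => Reaches W (.block l) s' T' Q) :
    Reaches W (.block (P :: l)) s (T' + T) Q := by
  obtain ⟨s₁, t₁, e₁, ht₁, s₂, t₂, e₂, ht₂, q⟩ := h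
  exact ⟨s₂, t₁ + t₂, .seq _ _ _ _ _ _ _ e₁ e₂, by omega, q⟩

theorem const {r k : ℕ} (hk : k < W) (h : Reaches W (.block l) (s.setReg r k) T Q) :
    Reaches W (.block (.const r k :: l)) s (T + 1) Q :=
  cons ⟨_, _, .const s r k hk, le_rfl, h⟩

theorem op {f : BinOp} {r a b : ℕ} (v : ℕ) (hv : f.eval (s.reg a) (s.reg b) = v) (hW : v < W)
    (h : Reaches W (.block l) (s.setReg r v) T Q) :
    Reaches W (.block (.op f r a b :: l)) s (T + 1) Q := by
  subst hv
  exact cons ⟨_, _, .op s f r a b hW, le_rfl, h⟩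

theorem load {r a : ℕ} (v : ℕ) (hv : s.mem (s.reg a) = v)
    (h : Reaches W (.block l) (s.setReg r v) T Q) :
    Reaches W (.block (.load r a :: l)) s (T + 1) Q := by
  subst hv
  exact cons ⟨_, _, .load s r a, le_rfl, h⟩

theorem store {a b : ℕ} (i v : ℕ) (hi : s.reg a = i) (hv : s.reg b = v)
    (h : Reaches W (.block l) (s.setMem i v) T Q) :
    Reaches W (.block (.store a b :: l)) s (T + 1) Q := by
  subst hi hv
  exact cons ⟨_, _, .store s a b, le_rfl, h⟩

theorem cond {r : ℕ} {P P' : Cmd} (h : s.reg r ≠ 0 → Reaches W P s T Q)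
    (h' : s.reg r = 0 → Reaches W P' s T Q) : Reaches W (.cond r P P') s (T + 1) Q := by
  by_cases hr : s.reg r = 0
  · obtain ⟨s', t, e, ht, q⟩ := h' hr
    exact ⟨s', t + 1, .condFalse _ _ _ _ _ _ hr e, by omega, q⟩
  · obtain ⟨s', t, e, ht, q⟩ := h hr
    exact ⟨s', t + 1, .condTrue _ _ _ _ _ _ hr e, by omega, q⟩

/-- A loop with the invariant `I k` after `k` rounds, of which there are `N`. -/
theorem loop {c : ℕ} {P : Cmd} {I : ℕ → State → Prop} {N : ℕ}
    (hc : ∀ k s, k ≤ N → I k s → (s.reg c ≠ 0 ↔ k < N))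
    (hP : ∀ k s, k < N → I k s → Reaches W P s T (I (k + 1))) (h : I 0 s) :
    Reaches W (.loop c P) s (N * (T + 1) + 1) (I N) := by
  -- Induction on the number `j` of remaining rounds, since `loopStep` splits off the first round.
  have key : ∀ j k s, k + j = N → I k s → Reaches W (.loop c P) s (j * (T + 1) + 1) (I N) := by
    intro j
    induction j with
    | zero =>
      intro k s hk hI
      obtain rfl : k = N := by omega
      have := hc k s le_rfl hI
      exact ⟨s, 1, .loopDone _ _ _ (by_contra fun h => absurd (this.1 h) (lt_irrefl k)), by omega,
        hI⟩
    | succ j ih =>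
      intro k s hk hI
      obtain ⟨s₁, t₁, e₁, ht₁, q₁⟩ := hP k s (by omega) hI
      obtain ⟨s₂, t₂, e₂, ht₂, q₂⟩ := ih (k + 1) s₁ (by omega) q₁
      refine ⟨s₂, _, .loopStep _ _ _ _ _ _ _ ((hc k s (by omega) hI).2 (by omega)) e₁ e₂, ?_, q₂⟩
      rw [add_mul]
      omega
  exact key N 0 s (by omega) h

end Reaches

end WordRAM

/-! ### Reading disjointness off the optimum -/

namespace PartialDom

/-- By inclusion–exclusion a union has at most `2 K` elements, with equality only if both
neighborhoods have the maximal size `K`, which forces both centers into `X`, and their intersection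
is empty. -/
theorem optimum_eq_two_mul_iff {V : Type*} [Finite V] (G : SimpleGraph V) (X : V → Prop) (K t : ℕ)
    (hX : ∀ v, X v → (closedNbhd G v).ncard = K) (hX' : ∀ v, ¬ X v → (closedNbhd G v).ncard < K)
    (ht : IsOptimum G t) :
    t = 2 * K ↔ ∃ x, X x ∧ ∃ x', X x' ∧ Disjoint (closedNbhd G x) (closedNbhd G x') := by
  have hle : ∀ v, (closedNbhd G v).ncard ≤ K := fun v => by
    by_cases h : X v
    · exact (hX v h).le
    · exact (hX' v h).le
  have hsum : ∀ u v, (closedNbhd G u ∪ closedNbhd G v).ncard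
      + (closedNbhd G u ∩ closedNbhd G v).ncard
      = (closedNbhd G u).ncard + (closedNbhd G v).ncard := fun u v =>
    Set.ncard_union_add_ncard_inter _ _
  obtain ⟨⟨x₁, x₂, hx⟩, hub⟩ := ht
  constructor
  · intro h
    have h0 := hsum x₁ x₂
    have h1 := hle x₁
    have h2 := hle x₂
    refine ⟨x₁, ?_, x₂, ?_, ?_⟩
    · by_contra hc
      have := hX' _ hc
      omega
    · by_contra hc
      have := hX' _ hc
      omega
    · rw [Set.disjoint_iff_inter_eq_empty, ← Set.ncard_eq_zero]
      omega
  · rintro ⟨x, hxX, x', hxX', hd⟩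
    have h0 := hsum x x'
    rw [hX x hxX, hX x' hxX', Set.disjoint_iff_inter_eq_empty.1 hd, Set.ncard_empty] at h0
    have h1 := hub ⟨x, x', rfl⟩
    have h2 := hsum x₁ x₂
    have h3 := hle x₁
    have h4 := hle x₂
    omega

theorem exists_optimum {V : Type*} [Finite V] [Nonempty V] (G : SimpleGraph V) :
    ∃ t, IsOptimum G t := by
  obtain ⟨p, hp⟩ := Finite.exists_max fun p : V × V => (closedNbhd G p.1 ∪ closedNbhd G p.2).ncard
  refine ⟨_, ⟨p.1, p.2, rfl⟩, ?_⟩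
  rintro k ⟨x₁, x₂, rfl⟩
  exact hp (x₁, x₂)

/-! ### The graph of a family of vectors -/

section Gadget

/-- The vertex that stands for coordinate `y` in the block of the groups `x / s` and `h`. It is
shared by both groups if the bit `b` is `1`, and otherwise by the vectors of the group `x / s` on
the side `σ`. -/
def gadget (s D : ℕ) (b : ℕ → ℕ → ℕ) (σ : ℕ → ℕ) (x h y : ℕ) : ℕ :=
  s * s + ((((x / s - (x / s - h) * b x y) * s + (h + (x / s - h) * b x y)) * D + y) * 3
    + (if b x y < σ x then 1 else 0) + b x y + b x y)

variable {s D : ℕ} {b : ℕ → ℕ → ℕ} {σ : ℕ → ℕ}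

theorem digits_inj {k a r a' r' : ℕ} (hr : r < k) (hr' : r' < k) (h : a * k + r = a' * k + r') :
    a = a' ∧ r = r' := by
  have hk : 0 < k := by omega
  have h1 : (a * k + r) / k = a := by
    rw [add_comm, Nat.add_mul_div_right _ _ hk, Nat.div_eq_of_lt hr, zero_add]
  have h2 : (a' * k + r') / k = a' := by
    rw [add_comm, Nat.add_mul_div_right _ _ hk, Nat.div_eq_of_lt hr', zero_add]
  have : a = a' := by rw [← h1, h, h2]
  subst this
  exact ⟨rfl, by omega⟩

theorem digits_lt {k a r l : ℕ} (ha : a < l) (hr : r < k) : a * k + r < l * k := by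
  calc a * k + r < a * k + k := by omega
    _ = (a + 1) * k := by ring
    _ ≤ l * k := Nat.mul_le_mul_right _ ha

theorem gadget_lt (hb : ∀ x y, b x y ≤ 1) (hσ : ∀ x, σ x ≤ 1) {x h y : ℕ} (hx : x < s * s)
    (hh : h < s) (hy : y < D) : gadget s D b σ x h y < s * s + s * s * D * 3 := by
  have hg : x / s < s := Nat.div_lt_of_lt_mul hx
  have hb' := hb x y
  have hσ' := hσ x
  unfold gadget
  obtain hb0 | hb1 : b x y = 0 ∨ b x y = 1 := by omega
  · rw [hb0]
    have := digits_lt (k := 3) (r := if 0 < σ x then 1 else 0)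
      (digits_lt (digits_lt hg hh) hy) (by split_ifs <;> omega)
    simpa using this
  · rw [hb1, mul_one]
    have := digits_lt (k := 3) (r := 2) (digits_lt (digits_lt (k := s) (l := s)
      (a := x / s - (x / s - h)) (r := h + (x / s - h)) (by omega) (by omega)) hy) (by omega)
    rw [if_neg (by omega)]
    omega

/-- A gadget number is a mixed radix expansion, so equal numbers have equal digits. The last digit
is `2` for a bit `1`, and otherwise the side `σ x`. The two group digits are `g, h` for a bit `0`;
for a bit `1`, truncated subtraction turns them into `min g h, max g h`, which forgets the order. -/
theorem gadget_inj (hb : ∀ x y, b x y ≤ 1) (hσ : ∀ x, σ x ≤ 1) {x h y x' h' y' : ℕ}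
    (hx : x < s * s) (hx' : x' < s * s) (hh : h < s) (hh' : h' < s) (hy : y < D) (hy' : y' < D)
    (he : gadget s D b σ x h y = gadget s D b σ x' h' y') :
    y = y' ∧ ((b x y = 1 ∧ b x' y = 1 ∧ (x / s = x' / s ∧ h = h' ∨ x / s = h' ∧ h = x' / s)) ∨
      (b x y = 0 ∧ b x' y = 0 ∧ σ x = σ x' ∧ x / s = x' / s ∧ h = h')) := by
  have hg : x / s < s := Nat.div_lt_of_lt_mul hx
  have hg' : x' / s < s := Nat.div_lt_of_lt_mul hx'
  have hb1 := hb x y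
  have hb2 := hb x' y'
  have hs1 := hσ x
  have hs2 := hσ x'
  unfold gadget at he
  generalize x / s = g at *
  generalize x' / s = g' at *
  have hq : ∀ g h β : ℕ, g < s → h < s → β ≤ 1 → h + (g - h) * β < s := by
    intro g h β h1 h2 h3
    obtain rfl | rfl : β = 0 ∨ β = 1 := by omega
    · omega
    · omega
  have hc : ∀ β τ : ℕ, β ≤ 1 → τ ≤ 1 → (if β < τ then 1 else 0) + β + β < 3 := by
    intro β τ h1 h2
    split_ifs <;> omega
  obtain ⟨e1, e2⟩ := digits_inj (k := 3)
    (a := ((g - (g - h) * b x y) * s + (h + (g - h) * b x y)) * D + y)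
    (a' := ((g' - (g' - h') * b x' y') * s + (h' + (g' - h') * b x' y')) * D + y')
    (hc (b x y) (σ x) hb1 hs1) (hc (b x' y') (σ x') hb2 hs2) (by omega)
  obtain ⟨e3, rfl⟩ := digits_inj hy hy' e1
  obtain ⟨e4, e5⟩ := digits_inj (hq g h _ hg hh hb1) (hq g' h' _ hg' hh' hb2) e3
  refine ⟨rfl, ?_⟩
  obtain h1 | h1 : b x y = 0 ∨ b x y = 1 := by omega
  all_goals obtain h2 | h2 : b x' y = 0 ∨ b x' y = 1 := by omega
  all_goals rw [h1, h2] at e2 e4 e5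
  · right
    refine ⟨h1, h2, ?_, by omega, by omega⟩
    split_ifs at e2 <;> omega
  · split_ifs at e2 <;> omega
  · split_ifs at e2 <;> omega
  · left
    exact ⟨h1, h2, by omega⟩

/-- The minimum and maximum of the two groups do not depend on their order; this is the common
neighbor of two vectors with a common `1`. -/
theorem gadget_symm {x x' y : ℕ} (h : b x y = 1) (h' : b x' y = 1) (hσ : ∀ x, σ x ≤ 1) :
    gadget s D b σ x (x' / s) y = gadget s D b σ x' (x / s) y := by
  have h1 := hσ x
  have h2 := hσ x'
  unfold gadget
  rw [h, h', if_neg (by omega), if_neg (by omega)]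
  simp only [mul_one]
  generalize x / s = g
  generalize x' / s = g'
  rw [show g - (g - g') = g' - (g' - g) by omega, show g' + (g - g') = g + (g' - g) by omega]

theorem le_gadget (x h y : ℕ) : s * s ≤ gadget s D b σ x h y := Nat.le_add_right _ _

theorem edge_bounds {e : ℕ} (he : e < s * s * s * D) :
    e / D / s < s * s ∧ e / D % s < s ∧ e % D < D := by
  have hD : 0 < D := Nat.pos_of_ne_zero (by rintro rfl; simp at he)
  have hs : 0 < s := Nat.pos_of_ne_zero (by rintro rfl; simp at he)
  refine ⟨?_, Nat.mod_lt _ hs, Nat.mod_lt _ hD⟩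
  rw [Nat.div_div_eq_div_mul]
  apply Nat.div_lt_of_lt_mul
  calc e < s * s * s * D := he
    _ = D * s * (s * s) := by ring

/-- The edges of the graph, one for each triple of a vector, a group and a coordinate. -/
def gadgetEdges (s D : ℕ) (b : ℕ → ℕ → ℕ) (σ : ℕ → ℕ) (hb : ∀ x y, b x y ≤ 1)
    (hσ : ∀ x, σ x ≤ 1) : List (Fin (s * s + s * s * D * 3) × Fin (s * s + s * s * D * 3)) :=
  List.ofFn fun e : Fin (s * s * s * D) =>
    (⟨e / D / s, (edge_bounds e.2).1.trans_le (Nat.le_add_right _ _)⟩,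
      ⟨gadget s D b σ (e / D / s) (e / D % s) (e % D),
        gadget_lt hb hσ (edge_bounds e.2).1 (edge_bounds e.2).2.1 (edge_bounds e.2).2.2⟩)

/-- The graph with these edges. -/
def gadgetGraph (s D : ℕ) (b : ℕ → ℕ → ℕ) (σ : ℕ → ℕ) (hb : ∀ x y, b x y ≤ 1)
    (hσ : ∀ x, σ x ≤ 1) : SimpleGraph (Fin (s * s + s * s * D * 3)) :=
  SimpleGraph.fromEdgeSet {z | z ∈ (gadgetEdges s D b σ hb hσ).map fun e => s(e.1, e.2)}

variable {hb : ∀ x y, b x y ≤ 1} {hσ : ∀ x, σ x ≤ 1}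

theorem mem_gadgetEdges {u v : Fin (s * s + s * s * D * 3)} :
    (u, v) ∈ gadgetEdges s D b σ hb hσ ↔ ∃ x h y, x < s * s ∧ h < s ∧ y < D ∧ u.val = x ∧
      v.val = gadget s D b σ x h y := by
  simp only [gadgetEdges, List.mem_ofFn, Prod.mk.injEq, Fin.ext_iff]
  constructor
  · rintro ⟨e, h1, h2⟩
    obtain ⟨b1, b2, b3⟩ := edge_bounds e.2
    exact ⟨_, _, _, b1, b2, b3, h1.symm, h2.symm⟩
  · rintro ⟨x, h, y, hx, hh, hy, h1, h2⟩
    have e1 : ((x * s + h) * D + y) / D = x * s + h := by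
      rw [mul_comm, Nat.mul_add_div (by omega), Nat.div_eq_of_lt hy, add_zero]
    have e2 : ((x * s + h) * D + y) % D = y := by
      rw [mul_comm, Nat.mul_add_mod, Nat.mod_eq_of_lt hy]
    have e3 : (x * s + h) / s = x := by
      rw [mul_comm, Nat.mul_add_div (by omega), Nat.div_eq_of_lt hh, add_zero]
    have e4 : (x * s + h) % s = h := by
      rw [mul_comm, Nat.mul_add_mod, Nat.mod_eq_of_lt hh]
    refine ⟨⟨(x * s + h) * D + y, digits_lt (digits_lt hx hh) hy⟩, ?_, ?_⟩
    · simp only [e1, e3, h1]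
    · simp only [e1, e2, e3, e4, h2]

theorem gadgetGraph_adj {u v : Fin (s * s + s * s * D * 3)} :
    (gadgetGraph s D b σ hb hσ).Adj u v ↔
      (u, v) ∈ gadgetEdges s D b σ hb hσ ∨ (v, u) ∈ gadgetEdges s D b σ hb hσ := by
  have key : (∃ e ∈ gadgetEdges s D b σ hb hσ, s(e.1, e.2) = s(u, v)) ↔
      (u, v) ∈ gadgetEdges s D b σ hb hσ ∨ (v, u) ∈ gadgetEdges s D b σ hb hσ := by
    constructor
    · rintro ⟨⟨e1, e2⟩, he, h⟩
      obtain ⟨rfl, rfl⟩ | ⟨rfl, rfl⟩ := Sym2.eq_iff.1 h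
      · exact .inl he
      · exact .inr he
    · rintro (h | h)
      · exact ⟨_, h, rfl⟩
      · exact ⟨_, h, Sym2.eq_swap⟩
  rw [gadgetGraph, SimpleGraph.fromEdgeSet_adj, Set.mem_ofPred_eq, List.mem_map, key]
  -- `fromEdgeSet` drops loops, but there are none: one end of each edge is below `s * s` and the
  -- other is not.
  refine and_iff_left_of_imp ?_
  rintro (h | h) rfl
  all_goals
    obtain ⟨x, h, y, hx, hh, hy, h1, h2⟩ := mem_gadgetEdges.1 h
    have := le_gadget (s := s) (D := D) (b := b) (σ := σ) x h y
    omega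

/-- The two ends of an edge lie on different sides of `s * s`, so they cannot be swapped. Once the
vector is fixed, both alternatives for a bit `1` in `gadget_inj` force the same group `h`, so the
index is determined. -/
theorem gadgetEdges_nodup :
    ((gadgetEdges s D b σ hb hσ).map fun e => s(e.1, e.2)).Nodup := by
  rw [gadgetEdges, List.map_ofFn, List.nodup_ofFn]
  intro e e' h
  obtain ⟨b1, b2, b3⟩ := edge_bounds e.2
  obtain ⟨c1, c2, c3⟩ := edge_bounds e'.2
  have l1 := le_gadget (s := s) (D := D) (b := b) (σ := σ) (e / D / s) (e / D % s) (e % D)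
  simp only [Function.comp, Sym2.eq_iff, Fin.ext_iff] at h
  obtain ⟨h1, h2⟩ | ⟨h1, h2⟩ := h
  · obtain ⟨h3, h4⟩ := gadget_inj hb hσ b1 c1 b2 c2 b3 c3 h2
    have h5 : e / D % s = e' / D % s := by
      rw [h1] at h4
      omega
    have h6 : e.val / D = e' / D := by
      rw [← Nat.div_add_mod (e.val / D) s, ← Nat.div_add_mod (e'.val / D) s, h1, h5]
    ext
    rw [← Nat.div_add_mod e.val D, ← Nat.div_add_mod e'.val D, h6, h3]
  · omega

theorem isEdgeList_gadgetEdges :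
    IsEdgeList (gadgetGraph s D b σ hb hσ) (gadgetEdges s D b σ hb hσ) := by
  refine ⟨gadgetEdges_nodup, fun z => ?_⟩
  induction z with
  | _ u v =>
    rw [SimpleGraph.mem_edgeSet, gadgetGraph_adj, List.mem_map]
    constructor
    · rintro ⟨⟨e1, e2⟩, he, h⟩
      obtain ⟨rfl, rfl⟩ | ⟨rfl, rfl⟩ := Sym2.eq_iff.1 h
      · exact .inl he
      · exact .inr he
    · rintro (h | h)
      · exact ⟨_, h, rfl⟩
      · exact ⟨_, h, Sym2.eq_swap⟩

theorem IsEdgeList.ncard_edgeSet {n : ℕ} {G : SimpleGraph (Fin n)} {E : List (Fin n × Fin n)}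
    (h : IsEdgeList G E) : G.edgeSet.ncard = E.length := by
  classical
  have : G.edgeSet = ((E.map fun e => s(e.1, e.2)).toFinset : Set (Sym2 (Fin n))) := by
    ext z
    simp only [List.coe_toFinset, Set.mem_ofPred_eq]
    exact (h.2 z).symm
  rw [this, Set.ncard_coe_finset, List.toFinset_card_of_nodup h.1, List.length_map]

theorem closedNbhd_vector (x : Fin (s * s + s * s * D * 3)) (hx : x.val < s * s) :
    Fin.val '' closedNbhd (gadgetGraph s D b σ hb hσ) x =
      insert x.val ((fun p : ℕ × ℕ => gadget s D b σ x p.1 p.2) ''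
        (Finset.range s ×ˢ Finset.range D : Finset (ℕ × ℕ))) := by
  rw [closedNbhd, Set.image_insert_eq]
  congr 1
  ext v
  simp only [Set.mem_image, SimpleGraph.mem_neighborSet, gadgetGraph_adj, mem_gadgetEdges,
    Finset.coe_product, Set.mem_prod, Finset.coe_range, Set.mem_Iio, Prod.exists]
  constructor
  · rintro ⟨v, (⟨_, h, y, h0, hh, hy, rfl, h2⟩ | ⟨_, h, y, h0, hh, hy, rfl, h2⟩), rfl⟩
    · exact ⟨h, y, ⟨hh, hy⟩, h2.symm⟩
    · have := le_gadget (s := s) (D := D) (b := b) (σ := σ) v h y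
      omega
  · rintro ⟨h, y, ⟨hh, hy⟩, rfl⟩
    exact ⟨⟨_, gadget_lt hb hσ hx hh hy⟩, .inl ⟨_, h, y, hx, hh, hy, rfl, rfl⟩, rfl⟩

theorem ncard_closedNbhd_vector (x : Fin (s * s + s * s * D * 3)) (hx : x.val < s * s) :
    (closedNbhd (gadgetGraph s D b σ hb hσ) x).ncard = s * D + 1 := by
  rw [← Set.ncard_image_of_injective _ Fin.val_injective, closedNbhd_vector x hx,
    Set.ncard_insert_of_notMem, Set.InjOn.ncard_image, Set.ncard_coe_finset,
    Finset.card_product, Finset.card_range, Finset.card_range]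
  · rintro ⟨h, y⟩ hp ⟨h', y'⟩ hp' he
    simp only [Finset.coe_product, Set.mem_prod, Finset.coe_range, Set.mem_Iio] at hp hp'
    obtain ⟨h1, h2⟩ := gadget_inj hb hσ hx hx hp.1 hp'.1 hp.2 hp'.2 he
    ext
    · simp only
      omega
    · exact h1
  · rintro ⟨p, -, hp⟩
    have := le_gadget (s := s) (D := D) (b := b) (σ := σ) x p.1 p.2
    simp only at hp
    omega

/-- Any two neighbors collide in the sense of `gadget_inj`, so all of them belong to the two groups
recorded in the vertex, each with `s` vectors. -/
theorem ncard_closedNbhd_gadget (v : Fin (s * s + s * s * D * 3)) (hv : s * s ≤ v.val) :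
    (closedNbhd (gadgetGraph s D b σ hb hσ) v).ncard ≤ 2 * s + 1 := by
  have hnb : ∀ u, (gadgetGraph s D b σ hb hσ).Adj v u → u.val < s * s ∧ ∃ h y, h < s ∧ y < D ∧
      v.val = gadget s D b σ u h y := by
    intro u hu
    obtain h | h := gadgetGraph_adj.1 hu
    all_goals obtain ⟨x, h, y, hx, hh, hy, h1, h2⟩ := mem_gadgetEdges.1 h
    · omega
    · subst h1
      exact ⟨hx, h, y, hh, hy, h2⟩
  refine (Set.ncard_insert_le _ _).trans (Nat.add_le_add_right ?_ 1)
  obtain h0 | ⟨u, hu⟩ := Set.eq_empty_or_nonempty ((gadgetGraph s D b σ hb hσ).neighborSet v)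
  · simp [h0]
  obtain ⟨hu1, h, y, hh, hy, hv1⟩ := hnb u hu
  have hsub : Fin.val '' (gadgetGraph s D b σ hb hσ).neighborSet v ⊆
      (((Finset.range s).image fun r => u / s * s + r) ∪
        ((Finset.range s).image fun r => h * s + r) : Finset ℕ) := by
    rintro _ ⟨w, hw, rfl⟩
    obtain ⟨hw1, h', y', hh', hy', hv2⟩ := hnb w hw
    have h1 := (gadget_inj hb hσ hu1 hw1 hh hh' hy hy' (hv1.symm.trans hv2)).2
    have h2 : w / s = u / s ∨ w / s = h := by omega
    simp only [Finset.coe_union, Finset.coe_image, Set.mem_union, Set.mem_image, Finset.coe_range,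
      Set.mem_Iio]
    have h3 : w.val / s * s + w % s = w := Nat.div_add_mod' _ _
    have h4 : w.val % s < s := Nat.mod_lt _ (by omega)
    obtain h2 | h2 := h2
    · exact .inl ⟨_, h4, by rw [← h2, h3]⟩
    · exact .inr ⟨_, h4, by rw [← h2, h3]⟩
  rw [← Set.ncard_image_of_injective _ Fin.val_injective]
  refine (Set.ncard_le_ncard hsub (Finset.finite_toSet _)).trans ?_
  rw [Set.ncard_coe_finset, two_mul]
  refine (Finset.card_union_le _ _).trans (Nat.add_le_add ?_ ?_)
  · exact Finset.card_image_le.trans (Finset.card_range s).le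
  · exact Finset.card_image_le.trans (Finset.card_range s).le

/-- Two vertices dominate `2 (s D + 1)` vertices if and only if two of the vectors are
orthogonal. -/
theorem gadgetGraph_optimum (hs : 0 < s) (hD : 3 ≤ D)
    (hside : ∀ x x', σ x = σ x' → ∃ y < D, b x y = 1 ∧ b x' y = 1) {t : ℕ}
    (ht : IsOptimum (gadgetGraph s D b σ hb hσ) t) :
    t = 2 * (s * D + 1) ↔
      ∃ x < s * s, ∃ x' < s * s, ∀ y < D, ¬ (b x y = 1 ∧ b x' y = 1) := by
  rw [optimum_eq_two_mul_iff (gadgetGraph s D b σ hb hσ)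
    (fun x => x.val < s * s) (s * D + 1) t (fun x hx => ncard_closedNbhd_vector x hx)
    (fun x hx => ?_) ht]
  · have key : ∀ x x' : Fin (s * s + s * s * D * 3), x.val < s * s → x'.val < s * s →
        (Disjoint (closedNbhd (gadgetGraph s D b σ hb hσ) x)
          (closedNbhd (gadgetGraph s D b σ hb hσ) x') ↔
        ∀ y < D, ¬ (b x y = 1 ∧ b x' y = 1)) := by
      intro x x' hx hx'
      rw [← Set.disjoint_image_iff Fin.val_injective, closedNbhd_vector x hx,
        closedNbhd_vector x' hx', Set.disjoint_left]
      constructor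
      · rintro hd y hy ⟨h1, h2⟩
        -- Each vector looks at the group of the other one.
        refine hd (a := gadget s D b σ x (x' / s) y)
          (.inr ⟨(x' / s, y), ?_, rfl⟩) (.inr ⟨(x / s, y), ?_, (gadget_symm h1 h2 hσ).symm⟩)
        · simp [hy, Nat.div_lt_of_lt_mul hx']
        · simp [hy, Nat.div_lt_of_lt_mul hx]
      · intro ho v hv hv'
        -- Different sides rule out collisions of two zero bits, so every common gadget vertex
        -- exhibits a common `1`.
        have hne : σ x ≠ σ x' := fun h => by
          obtain ⟨y, hy, h⟩ := hside x x' h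
          exact ho y hy h
        obtain rfl | ⟨⟨h, y⟩, hp, rfl⟩ := hv
        · obtain h1 | ⟨⟨h, y⟩, hp, h1⟩ := hv'
          · rw [h1] at hne
            exact hne rfl
          · have := le_gadget (s := s) (D := D) (b := b) (σ := σ) x' h y
            simp only at h1
            omega
        · obtain h1 | ⟨⟨h', y'⟩, hp', h1⟩ := hv'
          · have := le_gadget (s := s) (D := D) (b := b) (σ := σ) x h y
            simp only at h1
            omega
          · simp only [Finset.coe_product, Set.mem_prod, Finset.coe_range, Set.mem_Iio] at hp hp'
            obtain ⟨rfl, h3 | h3⟩ := gadget_inj hb hσ hx hx' hp.1 hp'.1 hp.2 hp'.2 h1.symm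
            · exact ho y hp.2 ⟨h3.1, h3.2.1⟩
            · exact hne h3.2.2.1
    constructor
    · rintro ⟨x, hx, x', hx', hd⟩
      exact ⟨x, hx, x', hx', (key x x' hx hx').1 hd⟩
    · rintro ⟨x, hx, x', hx', hd⟩
      exact ⟨⟨x, by omega⟩, hx, ⟨x', by omega⟩, hx', (key ⟨x, _⟩ ⟨x', _⟩ hx hx').2 hd⟩
  · have h1 := ncard_closedNbhd_gadget (hb := hb) (hσ := hσ) x (not_lt.1 hx)
    have h2 : s * 3 ≤ s * D := Nat.mul_le_mul_left s hD
    omega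

end Gadget

end PartialDom

open WordRAM

namespace OV

/-! ### The reduction as a program -/

/-- The vector with index `x % (2 * n)` belongs to the second family if this is `1`. -/
def family (n x : ℕ) : ℕ := x % (2 * n) / n

/-- The vectors with three additional coordinates, which make any two vectors of the same family
non-orthogonal. -/
def extBit (n d : ℕ) (data : ℕ → ℕ) (x y : ℕ) : ℕ :=
  if y < d then data (x % (2 * n) * d + y)
  else if (if y = d then 1 else 0) = family n x then 1 else 0

theorem family_le (n x : ℕ) : family n x ≤ 1 := by
  obtain rfl | hn := Nat.eq_zero_or_pos n
  · simp [family]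
  · have : x % (2 * n) < n * 2 := by
      rw [mul_comm n]
      exact Nat.mod_lt _ (by omega)
    have := Nat.div_lt_of_lt_mul this
    unfold family
    omega

theorem extBit_le {n d : ℕ} {data : ℕ → ℕ} (hdata : ∀ i, data i ≤ 1) (x y : ℕ) :
    extBit n d data x y ≤ 1 := by
  unfold extBit
  split_ifs
  · exact hdata _
  all_goals omega

/-- The lower bound `4` guarantees that the graph has at least as many edges as vertices; see
`vertices_le`. -/
theorem exists_groupSize (n : ℕ) : ∃ s, 4 ≤ s ∧ 2 * n ≤ s * s :=
  ⟨2 * n + 4, by omega, by nlinarith⟩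

/-- The number of groups, and of the vectors in each group. -/
def groupSize (n : ℕ) : ℕ := Nat.find (exists_groupSize n)

theorem four_le_groupSize (n : ℕ) : 4 ≤ groupSize n := (Nat.find_spec (exists_groupSize n)).1

theorem le_groupSize_sq (n : ℕ) : 2 * n ≤ groupSize n * groupSize n :=
  (Nat.find_spec (exists_groupSize n)).2

theorem groupSize_min {n k : ℕ} (hk : 4 ≤ k) (h : k < groupSize n) : k * k < 2 * n := by
  by_contra hc
  exact Nat.find_min (exists_groupSize n) h ⟨hk, not_lt.1 hc⟩

/-- The number of edges of the graph. -/
def edgeCount (n d : ℕ) : ℕ := groupSize n * groupSize n * groupSize n * (d + 3)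

theorem edgeCount_pos (n d : ℕ) : 0 < edgeCount n d := by
  have := four_le_groupSize n
  unfold edgeCount
  positivity

/-- The parameters of the reduction are in the registers after `B`, and those before `B` are
empty. -/
structure Env (B n d : ℕ) (s : State) : Prop where
  low : ∀ r < B, s.reg r = 0
  one : s.reg (B + 1) = 1
  two : s.reg (B + 2) = 2
  three : s.reg (B + 3) = 3
  size : s.reg (B + 4) = n
  dim : s.reg (B + 5) = d
  extDim : s.reg (B + 6) = d + 3
  group : s.reg (B + 7) = groupSize n
  edges : s.reg (B + 8) = edgeCount n d
  offset : s.reg (B + 9) = 2 * edgeCount n d + 2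
  entries : s.reg (B + 10) = 2 * n * d
  rows : s.reg (B + 11) = 2 * n
  vectors : s.reg (B + 12) = groupSize n * groupSize n
  target : s.reg (B + 13) = 2 * (groupSize n * (d + 3) + 1)

theorem Env.setReg {B n d : ℕ} {s : State} (h : Env B n d s) {k : ℕ} (hk : 14 ≤ k) (v : ℕ) :
    Env B n d (s.setReg (B + k) v) := by
  obtain ⟨h0, h1, h2, h3, h4, h5, h6, h7, h8, h9, h10, h11, h12, h13⟩ := h
  constructor
  · intro r hr
    rw [State.reg_setReg, if_neg (by omega), h0 r hr]
  all_goals rw [State.reg_setReg, if_neg (by omega)]; assumption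

theorem Env.setMem {B n d : ℕ} {s : State} (h : Env B n d s) (i v : ℕ) :
    Env B n d (s.setMem i v) := by
  obtain ⟨h0, h1, h2, h3, h4, h5, h6, h7, h8, h9, h10, h11, h12, h13⟩ := h
  exact ⟨h0, h1, h2, h3, h4, h5, h6, h7, h8, h9, h10, h11, h12, h13⟩

/-- Search for the number of groups. -/
def groupLoop (B : ℕ) : Cmd :=
  .loop (B + 15) (.block [.op .add (B + 7) (B + 7) (B + 1), .op .mul (B + 14) (B + 7) (B + 7),
    .op .lt (B + 15) (B + 14) (B + 11)])

/-- Compute the parameters of the reduction. -/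
def setup (B : ℕ) : Cmd := .block [.const (B + 1) 1, .const (B + 2) 2, .const (B + 3) 3,
  .const (B + 14) 0, .load (B + 4) (B + 14), .load (B + 5) (B + 1),
  .op .add (B + 6) (B + 5) (B + 3), .op .add (B + 11) (B + 4) (B + 4), .const (B + 7) 4,
  .op .mul (B + 14) (B + 7) (B + 7), .op .lt (B + 15) (B + 14) (B + 11), groupLoop B,
  .op .mul (B + 12) (B + 7) (B + 7), .op .mul (B + 8) (B + 12) (B + 7),
  .op .mul (B + 8) (B + 8) (B + 6), .op .add (B + 9) (B + 8) (B + 8),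
  .op .add (B + 9) (B + 9) (B + 2), .op .mul (B + 10) (B + 11) (B + 5),
  .op .mul (B + 13) (B + 7) (B + 6), .op .add (B + 13) (B + 13) (B + 1),
  .op .add (B + 13) (B + 13) (B + 13)]

/-- Copy the vectors to the cells after those for the graph. -/
def copyData (B : ℕ) : Cmd := .block [.const (B + 14) 0, .op .lt (B + 15) (B + 14) (B + 10),
  .loop (B + 15) (.block [.op .add (B + 16) (B + 14) (B + 2), .load (B + 17) (B + 16),
    .op .add (B + 16) (B + 9) (B + 14), .store (B + 16) (B + 17),
    .op .add (B + 14) (B + 14) (B + 1), .op .lt (B + 15) (B + 14) (B + 10)])]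

/-- Compute the vector, the group, the coordinate and the bit of an edge from its index. -/
def decodeEdge (B : ℕ) : Cmd := .block [.op .mod (B + 16) (B + 14) (B + 6),
  .op .div (B + 22) (B + 14) (B + 6), .op .mod (B + 17) (B + 22) (B + 7),
  .op .div (B + 18) (B + 22) (B + 7), .op .div (B + 19) (B + 18) (B + 7),
  .op .mod (B + 22) (B + 18) (B + 11), .op .div (B + 20) (B + 22) (B + 4),
  .op .lt (B + 23) (B + 16) (B + 5),
  .cond (B + 23)
    (.block [.op .mul (B + 22) (B + 22) (B + 5), .op .add (B + 22) (B + 22) (B + 16),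
      .op .add (B + 22) (B + 9) (B + 22), .load (B + 21) (B + 22)])
    (.block [.op .eq (B + 22) (B + 16) (B + 5), .op .eq (B + 21) (B + 22) (B + 20)])]

/-- Write the two ends of an edge. -/
def writeEdge (B : ℕ) : Cmd := .block [.op .sub (B + 22) (B + 19) (B + 17),
  .op .mul (B + 22) (B + 22) (B + 21), .op .sub (B + 23) (B + 19) (B + 22),
  .op .add (B + 24) (B + 17) (B + 22), .op .mul (B + 23) (B + 23) (B + 7),
  .op .add (B + 23) (B + 23) (B + 24), .op .mul (B + 23) (B + 23) (B + 6),
  .op .add (B + 23) (B + 23) (B + 16), .op .mul (B + 23) (B + 23) (B + 3),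
  .op .lt (B + 24) (B + 21) (B + 20), .op .add (B + 23) (B + 23) (B + 24),
  .op .add (B + 23) (B + 23) (B + 21), .op .add (B + 23) (B + 23) (B + 21),
  .op .add (B + 23) (B + 12) (B + 23), .op .add (B + 22) (B + 14) (B + 14),
  .op .add (B + 22) (B + 22) (B + 2), .store (B + 22) (B + 18),
  .op .add (B + 22) (B + 22) (B + 1), .store (B + 22) (B + 23),
  .op .add (B + 14) (B + 14) (B + 1), .op .lt (B + 15) (B + 14) (B + 8)]

/-- Write the graph into the memory. -/
def writeGraph (B : ℕ) : Cmd := .block [.const (B + 16) 0, .op .mul (B + 17) (B + 12) (B + 6),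
  .op .mul (B + 17) (B + 17) (B + 3), .op .add (B + 17) (B + 12) (B + 17),
  .store (B + 16) (B + 17), .store (B + 1) (B + 8), .const (B + 14) 0,
  .op .lt (B + 15) (B + 14) (B + 8), .loop (B + 15) (.block [decodeEdge B, writeEdge B])]

/-- Erase the copy of the vectors. -/
def clearData (B : ℕ) : Cmd := .block [.const (B + 14) 0, .op .lt (B + 15) (B + 14) (B + 10),
  .loop (B + 15) (.block [.op .add (B + 16) (B + 9) (B + 14), .const (B + 17) 0,
    .store (B + 16) (B + 17), .op .add (B + 14) (B + 14) (B + 1),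
    .op .lt (B + 15) (B + 14) (B + 10)])]

/-- Solve Orthogonal Vectors by a program `P` for Partial 2-Dominating Set. -/
def reduction (P : Cmd) : Cmd := .block [setup (P.regBound + 1), copyData (P.regBound + 1),
  writeGraph (P.regBound + 1), clearData (P.regBound + 1), P,
  .op .eq 0 0 (P.regBound + 1 + 13)]

/-! ### Correctness and running time of the reduction program -/

section Correct

variable {W B n d : ℕ} {data : ℕ → ℕ}

/-- Makes copying and erasing the vectors cost `O(m)`, and places the copy entirely after the
original. -/
theorem entries_le (n d : ℕ) : 4 * (2 * n * d) ≤ edgeCount n d := by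
  have h1 := le_groupSize_sq n
  have h2 := four_le_groupSize n
  calc 4 * (2 * n * d) ≤ groupSize n * (groupSize n * groupSize n * (d + 3)) := by gcongr; omega
    _ = edgeCount n d := by unfold edgeCount; ring

/-- The left side is at most `4 s² D`, hence at most `s³ D` because `s ≥ 4`. This supplies the
density condition `n ≤ m` of the graph problem. -/
theorem vertices_le (n d : ℕ) :
    groupSize n * groupSize n + groupSize n * groupSize n * (d + 3) * 3 ≤ edgeCount n d := by
  have h2 := four_le_groupSize n
  have h3 : 4 * (groupSize n * groupSize n * (d + 3)) ≤
      groupSize n * (groupSize n * groupSize n * (d + 3)) := by gcongr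
  have h4 : groupSize n * groupSize n * 1 ≤ groupSize n * groupSize n * (d + 3) := by gcongr; omega
  unfold edgeCount
  nlinarith

theorem setup_reaches (hW : 4 * edgeCount n d < W) {s : State} (hreg : ∀ r, s.reg r = 0)
    (h0 : s.mem 0 = n) (h1 : s.mem 1 = d) :
    Reaches W (setup B) s (4 * edgeCount n d) fun s' => Env B n d s' ∧ s'.mem = s.mem := by
  have hV := vertices_le n d
  have hT := entries_le n d
  have hs4 := four_le_groupSize n
  have hs2 := le_groupSize_sq n
  have hss : groupSize n * 4 ≤ groupSize n * groupSize n := by gcongr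
  have hsd : groupSize n * (d + 3) * 4 ≤ groupSize n * (d + 3) * groupSize n := by gcongr
  have hsd' : 1 * (d + 3) ≤ groupSize n * (d + 3) := by gcongr; omega
  have hsd'' : groupSize n * (d + 3) * groupSize n = groupSize n * groupSize n * (d + 3) := by ring
  have hs3 : groupSize n * groupSize n * groupSize n * 1 ≤ edgeCount n d := by
    unfold edgeCount
    gcongr
    omega
  have hmain : Reaches W (setup B) s (1 + 1 + 1 + 1 + 1 + 1 + 1 + 1 + 1 + 1 +
      ((groupSize n - 4) * (1 + 1 + 1 + 1 + 1) + 1) + 1 + 1 + 1 + 1 + 1 + 1 + 1 + 1 + 1 + 1 + 1)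
      fun s' => Env B n d s' ∧ s'.mem = s.mem := by
    refine .const (by omega) (.const (by omega) (.const (by omega) (.const (by omega) ?_)))
    refine .load n (by simp [h0]) (.load d (by simp [h1]) ?_)
    refine .op (d + 3) (by simp [BinOp.eval]) (by omega) ?_
    refine .op (2 * n) (by simp [BinOp.eval, two_mul]) (by omega) ?_
    refine .const (by omega) (.op (4 * 4) (by simp [BinOp.eval]) (by omega) ?_)
    refine .op (if 4 * 4 < 2 * n then 1 else 0) (by simp [BinOp.eval]) (by split_ifs <;> omega) ?_
    refine .cons ((Reaches.loop (T := 1 + 1 + 1 + 1) (N := groupSize n - 4) (I := fun k s' =>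
      (∀ r < B, s'.reg r = 0) ∧ s'.mem = s.mem ∧ s'.reg (B + 1) = 1 ∧ s'.reg (B + 2) = 2 ∧
      s'.reg (B + 3) = 3 ∧ s'.reg (B + 4) = n ∧ s'.reg (B + 5) = d ∧ s'.reg (B + 6) = d + 3 ∧
      s'.reg (B + 11) = 2 * n ∧ s'.reg (B + 7) = 4 + k ∧
      s'.reg (B + 15) = if (4 + k) * (4 + k) < 2 * n then 1 else 0) ?_ ?_ ?_).weaken le_rfl ?_)
    -- The search stops exactly at `groupSize n`: every smaller candidate from `4` on has too small
    -- a square, by minimality.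
    · rintro k s hk ⟨-, -, -, -, -, -, -, -, -, -, h⟩
      rw [h]
      by_cases hk' : k < groupSize n - 4
      · have := groupSize_min (n := n) (k := 4 + k) (by omega) (by omega)
        simp [this, hk']
      · obtain rfl : k = groupSize n - 4 := by omega
        rw [show 4 + (groupSize n - 4) = groupSize n by omega, if_neg (by omega)]
        simp
    · rintro k s hk ⟨g0, g1, g2, g3, g4, g5, g6, g7, g8, g9, -⟩
      have hle : (4 + (k + 1)) * (4 + (k + 1)) ≤ groupSize n * groupSize n := by gcongr <;> omega
      refine .op (4 + (k + 1)) (by simp [BinOp.eval, g9, g2]; omega) (by omega) ?_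
      refine .op ((4 + (k + 1)) * (4 + (k + 1))) (by simp [BinOp.eval]) (by omega) ?_
      refine .op (if (4 + (k + 1)) * (4 + (k + 1)) < 2 * n then 1 else 0)
        (by simp [BinOp.eval, g8]) (by split_ifs <;> omega) (.nil ?_)
      refine ⟨fun r hr => ?_, by simp [g1], by simp [g2], by simp [g3], by simp [g4], by simp [g5],
        by simp [g6], by simp [g7], by simp [g8], by simp, by simp⟩
      simp only [State.reg_setReg]
      repeat rw [if_neg (by omega)]
      exact g0 r hr
    · refine ⟨fun r hr => ?_, by simp, by simp, by simp, by simp, by simp, by simp,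
        by simp, by simp, by simp, by simp⟩
      simp only [State.reg_setReg]
      repeat rw [if_neg (by omega)]
      exact hreg r
    · rintro s' ⟨g0, g1, g2, g3, g4, g5, g6, g7, g8, g9, -⟩
      rw [show 4 + (groupSize n - 4) = groupSize n by omega] at g9
      refine .op (groupSize n * groupSize n) (by simp [BinOp.eval, g9]) (by omega) ?_
      refine .op (groupSize n * groupSize n * groupSize n) (by simp [BinOp.eval, g9]) (by omega) ?_
      refine .op (edgeCount n d) (by simp [BinOp.eval, g7, edgeCount]) (by omega) ?_
      refine .op (2 * edgeCount n d) (by simp [BinOp.eval, two_mul]) (by omega) ?_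
      refine .op (2 * edgeCount n d + 2) (by simp [BinOp.eval, g3]) (by omega) ?_
      refine .op (2 * n * d) (by simp [BinOp.eval, g8, g6]) (by omega) ?_
      refine .op (groupSize n * (d + 3)) (by simp [BinOp.eval, g9, g7]) (by omega) ?_
      refine .op (groupSize n * (d + 3) + 1) (by simp [BinOp.eval, g2]) (by omega) ?_
      refine .op (2 * (groupSize n * (d + 3) + 1)) (by simp [BinOp.eval, two_mul]) (by omega) ?_
      refine .nil ⟨⟨fun r hr => ?_, by simp [g2], by simp [g3], by simp [g4], by simp [g5],
        by simp [g6], by simp [g7], by simp [g9], by simp, by simp, by simp, by simp [g8],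
        by simp, by simp⟩, by simp [g1]⟩
      simp only [State.reg_setReg]
      repeat rw [if_neg (by omega)]
      exact g0 r hr
  exact hmain.weaken (by omega) fun _ h => h

/-- The entries of the vectors are in the cells after those for the graph. -/
def HasData (n d : ℕ) (data : ℕ → ℕ) (s : State) : Prop :=
  (∀ i < 2 * n * d, s.mem (2 * edgeCount n d + 2 + i) = data i) ∧
    ∀ i, 2 * n * d ≤ i → s.mem (2 * edgeCount n d + 2 + i) = 0

theorem copyData_reaches (hW : 4 * edgeCount n d < W) {s : State} (he : Env B n d s)
    (hm : ∀ i, s.mem (i + 2) = if i < 2 * n * d then data i else 0) :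
    Reaches W (copyData B) s (8 * edgeCount n d) fun s' => Env B n d s' ∧ HasData n d data s' := by
  have hT := entries_le n d
  have hE := edgeCount_pos n d
  have hoff := he.offset
  have hstart : Reaches W (copyData B) s (1 + (2 * n * d * 8 + 1) + 1 + 1) fun s' => Env B n d s' ∧
      HasData n d data s' := by
    refine .const (by omega) (.op (if 0 < 2 * n * d then 1 else 0) (by simp [BinOp.eval, he.entries])
      (by split_ifs <;> omega) ?_)
    refine .cons (l := []) ((Reaches.loop (T := 7) (N := 2 * n * d) (I := fun k s => Env B n d s ∧
      s.reg (B + 14) = k ∧ s.reg (B + 15) = (if k < 2 * n * d then 1 else 0) ∧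
      (∀ i < 2 * n * d, s.mem (i + 2) = data i) ∧
      (∀ i < k, s.mem (2 * edgeCount n d + 2 + i) = data i) ∧
      (∀ i, k ≤ i → s.mem (2 * edgeCount n d + 2 + i) = 0)) ?_ ?_ ?_).weaken
      le_rfl ?_)
    · rintro k s - ⟨-, -, h, -⟩
      rw [h]
      split_ifs <;> simp [*]
    · rintro k s hk ⟨he, h14, h15, hm1, hm2, hm3⟩
      refine .op (k + 2) (by simp [BinOp.eval, h14, he.two]) (by omega) ?_
      refine .load (data k) (by simp [hm1 k hk]) ?_
      refine .op (2 * edgeCount n d + 2 + k) (by simp [BinOp.eval, h14, he.offset]) (by omega) ?_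
      refine .store (2 * edgeCount n d + 2 + k) (data k) (by simp) (by simp) ?_
      refine .op (k + 1) (by simp [BinOp.eval, h14, he.one]) (by omega) ?_
      refine .op (if k + 1 < 2 * n * d then 1 else 0) (by simp [BinOp.eval, he.entries])
        (by split_ifs <;> omega) (.nil ⟨?_, by simp, by simp, ?_, ?_, ?_⟩)
      · repeat' first | with_reducible exact he | with_reducible apply Env.setMem |
          with_reducible apply Env.setReg | omega
      · intro i hi
        simp only [State.mem_setReg, State.mem_setMem]
        rw [if_neg (by omega), hm1 i hi]
      · intro i hi
        simp only [State.mem_setReg, State.mem_setMem]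
        by_cases hik : i = k
        · rw [if_pos (by omega), hik]
        · rw [if_neg (by omega), hm2 i (by omega)]
      · intro i hi
        simp only [State.mem_setReg, State.mem_setMem]
        rw [if_neg (by omega), hm3 i (by omega)]
    · refine ⟨?_, by simp, by simp, ?_, ?_, ?_⟩
      · repeat' first | with_reducible exact he | with_reducible apply Env.setReg | omega
      · intro i hi
        simp [hm, hi]
      · intro i hi
        omega
      · intro i hi
        have := hm (2 * edgeCount n d + i)
        rw [if_neg (by omega), show 2 * edgeCount n d + i + 2 = 2 * edgeCount n d + 2 + i by omega]
          at this
        simpa using this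
    · rintro s' ⟨he, -, -, -, h1, h2⟩
      exact .nil ⟨he, h1, h2⟩
  exact hstart.weaken (by omega) fun _ h => h

/-- The given program is only specified on a memory that is `0` beyond its input, so the copied
vectors must disappear before it starts. -/
theorem clearData_reaches (hW : 4 * edgeCount n d < W) {s : State} (he : Env B n d s)
    (hm : HasData n d data s) :
    Reaches W (clearData B) s (8 * edgeCount n d) fun s' => Env B n d s' ∧
      (∀ i, s'.mem (2 * edgeCount n d + 2 + i) = 0) ∧
      ∀ i < 2 * edgeCount n d + 2, s'.mem i = s.mem i := by
  have hT := entries_le n d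
  have hE := edgeCount_pos n d
  have hstart : Reaches W (clearData B) s (1 + (2 * n * d * 7 + 1) + 1 + 1) fun s' => Env B n d s' ∧
      (∀ i, s'.mem (2 * edgeCount n d + 2 + i) = 0) ∧
      ∀ i < 2 * edgeCount n d + 2, s'.mem i = s.mem i := by
    refine .const (by omega) (.op (if 0 < 2 * n * d then 1 else 0)
      (by simp [BinOp.eval, he.entries]) (by split_ifs <;> omega) ?_)
    refine .cons (l := []) ((Reaches.loop (T := 6) (N := 2 * n * d) (I := fun k s' => Env B n d s' ∧
      s'.reg (B + 14) = k ∧ s'.reg (B + 15) = (if k < 2 * n * d then 1 else 0) ∧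
      (∀ i, (i < k ∨ 2 * n * d ≤ i) → s'.mem (2 * edgeCount n d + 2 + i) = 0) ∧
      (∀ i < 2 * edgeCount n d + 2, s'.mem i = s.mem i)) ?_ ?_ ?_).weaken
      le_rfl ?_)
    · rintro k s - ⟨-, -, h, -⟩
      rw [h]
      split_ifs <;> simp [*]
    · rintro k s hk ⟨he, h14, h15, hm1, hm2⟩
      refine .op (2 * edgeCount n d + 2 + k) (by simp [BinOp.eval, h14, he.offset]) (by omega) ?_
      refine .const (by omega) (.store (2 * edgeCount n d + 2 + k) 0 (by simp) (by simp) ?_)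
      refine .op (k + 1) (by simp [BinOp.eval, h14, he.one]) (by omega) ?_
      refine .op (if k + 1 < 2 * n * d then 1 else 0) (by simp [BinOp.eval, he.entries])
        (by split_ifs <;> omega) (.nil ⟨?_, by simp, by simp, ?_, ?_⟩)
      · repeat' first | with_reducible exact he | with_reducible apply Env.setMem |
          with_reducible apply Env.setReg | omega
      · intro i hi
        simp only [State.mem_setReg, State.mem_setMem]
        by_cases hik : i = k
        · rw [if_pos (by omega)]
        · rw [if_neg (by omega), hm1 i (by omega)]
      · intro i hi
        simp only [State.mem_setReg, State.mem_setMem]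
        rw [if_neg (by omega), hm2 i hi]
    · refine ⟨?_, by simp, by simp, ?_, ?_⟩
      · repeat' first | with_reducible exact he | with_reducible apply Env.setReg | omega
      · intro i hi
        exact hm.2 i (by omega)
      · exact fun i hi => rfl
    · rintro s' ⟨he, -, -, h1, h2⟩
      exact .nil ⟨he, fun i => h1 i (by omega), h2⟩
  exact hstart.weaken (by omega) fun _ h => h

theorem decodeEdge_reaches (hW : 4 * edgeCount n d < W) {s : State} (he : Env B n d s)
    (hn : 1 ≤ n) (hm : HasData n d data s) {e : ℕ} (hlt : e < edgeCount n d)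
    (h14 : s.reg (B + 14) = e) :
    Reaches W (decodeEdge B) s 15 fun s' => Env B n d s' ∧ s'.mem = s.mem ∧
      s'.reg (B + 14) = e ∧ s'.reg (B + 16) = e % (d + 3) ∧
      s'.reg (B + 17) = e / (d + 3) % groupSize n ∧ s'.reg (B + 18) = e / (d + 3) / groupSize n ∧
      s'.reg (B + 19) = e / (d + 3) / groupSize n / groupSize n ∧
      s'.reg (B + 20) = family n (e / (d + 3) / groupSize n) ∧
      s'.reg (B + 21) = extBit n d data (e / (d + 3) / groupSize n) (e % (d + 3)) := by
  have hT := entries_le n d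
  have hE := edgeCount_pos n d
  have l1 : e % (d + 3) ≤ e := Nat.mod_le _ _
  have l2 : e / (d + 3) ≤ e := Nat.div_le_self _ _
  have l3 : e / (d + 3) % groupSize n ≤ e := (Nat.mod_le _ _).trans l2
  have l4 : e / (d + 3) / groupSize n ≤ e := (Nat.div_le_self _ _).trans l2
  have l5 : e / (d + 3) / groupSize n / groupSize n ≤ e := (Nat.div_le_self _ _).trans l4
  have l6 : e / (d + 3) / groupSize n % (2 * n) ≤ e := (Nat.mod_le _ _).trans l4
  have l7 := family_le n (e / (d + 3) / groupSize n)
  have l8 : e / (d + 3) / groupSize n % (2 * n) < 2 * n := Nat.mod_lt _ (by omega)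
  refine .op (e % (d + 3)) (by simp [BinOp.eval, h14, he.extDim]) (by omega) ?_
  refine .op (e / (d + 3)) (by simp [BinOp.eval, h14, he.extDim]) (by omega) ?_
  refine .op (e / (d + 3) % groupSize n) (by simp [BinOp.eval, he.group]) (by omega) ?_
  refine .op (e / (d + 3) / groupSize n) (by simp [BinOp.eval, he.group]) (by omega) ?_
  refine .op (e / (d + 3) / groupSize n / groupSize n) (by simp [BinOp.eval, he.group])
    (by omega) ?_
  -- With the quotients and remainders as variables, the remaining range conditions are linear.
  generalize e / (d + 3) / groupSize n / groupSize n = g at *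
  generalize e / (d + 3) % groupSize n = h at *
  generalize hx : e / (d + 3) / groupSize n = x at *
  generalize e % (d + 3) = y at *
  generalize e / (d + 3) = u at *
  refine .op (x % (2 * n)) (by simp [BinOp.eval, he.rows]) (by omega) ?_
  refine .op (family n x) (by simp [BinOp.eval, he.size, family]) (by omega) ?_
  refine .op (if y < d then 1 else 0) (by simp [BinOp.eval, he.dim])
    (by split_ifs <;> omega) ?_
  -- An original coordinate is looked up in the copied data; an additional one is computed from the
  -- family.
  refine .cons (l := []) (.cond (T := 5) (fun hc => ?_) (fun hc => ?_))
  · have hyd : y < d := by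
      by_contra hyd
      simp [hyd] at hc
    have hlt' := PartialDom.digits_lt l8 hyd
    refine .op (x % (2 * n) * d) (by simp [BinOp.eval, he.dim]) (by omega) ?_
    refine .op (x % (2 * n) * d + y) (by simp [BinOp.eval]) (by omega) ?_
    refine .op (2 * edgeCount n d + 2 + (x % (2 * n) * d + y)) (by simp [BinOp.eval, he.offset])
      (by omega) ?_
    refine .load (data (x % (2 * n) * d + y)) (by simp [hm.1 _ hlt']) (.nil (.nil ?_))
    refine ⟨?_, by simp, by simp [h14], by simp, by simp, by simp, by simp, by simp,
      by simp [extBit, hyd]⟩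
    repeat' first | with_reducible exact he | with_reducible apply Env.setReg | omega
  · have hyd : ¬ y < d := by
      intro hyd
      simp [hyd] at hc
    refine .weaken (T := 3) ?_ (by omega) fun _ h => h
    refine .op (if y = d then 1 else 0) (by simp [BinOp.eval, he.dim])
      (by split_ifs <;> omega) ?_
    refine .op (extBit n d data x y) (by simp [BinOp.eval, extBit, hyd]) ?_ (.nil (.nil ?_))
    · unfold extBit
      rw [if_neg hyd]
      split_ifs <;> omega
    · refine ⟨?_, by simp, by simp [h14], by simp, by simp, by simp, by simp, by simp,
        by simp⟩
      repeat' first | with_reducible exact he | with_reducible apply Env.setReg | omega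

/-- The cells `0, …, 2 k + 1` contain the numbers of vertices and edges and the first `k` edges. -/
def HasGraph (n d : ℕ) (data : ℕ → ℕ) (k : ℕ) (s : State) : Prop :=
  s.mem 0 = groupSize n * groupSize n + groupSize n * groupSize n * (d + 3) * 3 ∧
    s.mem 1 = edgeCount n d ∧
    ∀ e < k, s.mem (2 * e + 2) = e / (d + 3) / groupSize n ∧
      s.mem (2 * e + 3) = PartialDom.gadget (groupSize n) (d + 3) (extBit n d data) (family n)
        (e / (d + 3) / groupSize n) (e / (d + 3) % groupSize n) (e % (d + 3))

theorem HasData.setMem {s : State} (hm : HasData n d data s) {i : ℕ}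
    (hi : i < 2 * edgeCount n d + 2) (v : ℕ) : HasData n d data (s.setMem i v) := by
  refine ⟨fun j hj => ?_, fun j hj => ?_⟩
  · rw [State.mem_setMem, if_neg (by omega), hm.1 j hj]
  · rw [State.mem_setMem, if_neg (by omega), hm.2 j hj]

theorem HasData.setReg {s : State} (hm : HasData n d data s) (i v : ℕ) :
    HasData n d data (s.setReg i v) := hm

/-- The formula for `gadget` is arithmetic with one comparison, so it is evaluated without
branching. Each intermediate value is bounded by the final vertex number or by a digit bound, so it
fits into a word. -/
theorem writeEdge_reaches (hW : 4 * edgeCount n d < W) (hdata : ∀ i, data i ≤ 1) {s : State}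
    (he : Env B n d s) (hm : HasData n d data s) {e : ℕ} (hlt : e < edgeCount n d)
    (hg : HasGraph n d data e s)
    (h14 : s.reg (B + 14) = e) (h16 : s.reg (B + 16) = e % (d + 3))
    (h17 : s.reg (B + 17) = e / (d + 3) % groupSize n)
    (h18 : s.reg (B + 18) = e / (d + 3) / groupSize n)
    (h19 : s.reg (B + 19) = e / (d + 3) / groupSize n / groupSize n)
    (h20 : s.reg (B + 20) = family n (e / (d + 3) / groupSize n))
    (h21 : s.reg (B + 21) = extBit n d data (e / (d + 3) / groupSize n) (e % (d + 3))) :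
    Reaches W (writeEdge B) s 22 fun s' => (Env B n d s' ∧ s'.reg (B + 14) = e + 1 ∧
      s'.reg (B + 15) = (if e + 1 < edgeCount n d then 1 else 0) ∧
      HasData n d data s' ∧ HasGraph n d data (e + 1) s') := by
  have hV := vertices_le n d
  obtain ⟨hx, hh, hy⟩ := PartialDom.edge_bounds hlt
  have hgl : e / (d + 3) / groupSize n / groupSize n < groupSize n := Nat.div_lt_of_lt_mul hx
  have hgad := PartialDom.gadget_lt (b := extBit n d data) (σ := family n) (extBit_le hdata)
    (family_le n) hx hh hy
  have hb := extBit_le (n := n) (d := d) hdata (e / (d + 3) / groupSize n) (e % (d + 3))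
  have hs4 := four_le_groupSize n
  have hss : groupSize n * 1 ≤ groupSize n * groupSize n := by gcongr; omega
  generalize hgd : PartialDom.gadget (groupSize n) (d + 3) (extBit n d data) (family n)
      (e / (d + 3) / groupSize n) (e / (d + 3) % groupSize n) (e % (d + 3)) = v at *
  have hgd' := hgd
  unfold PartialDom.gadget at hgd
  generalize e / (d + 3) / groupSize n / groupSize n = g at *
  generalize hhe : e / (d + 3) % groupSize n = h at *
  generalize hxe : e / (d + 3) / groupSize n = x at *
  generalize hye : e % (d + 3) = y at *
  generalize extBit n d data x y = b at *
  have hwb : (g - h) * b ≤ g - h := by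
    simpa using Nat.mul_le_mul_left (g - h) hb
  refine .op (g - h) (by simp [BinOp.eval, h19, h17]) (by omega) ?_
  refine .op ((g - h) * b) (by simp [BinOp.eval, h21]) (by omega) ?_
  generalize (g - h) * b = w at *
  refine .op (g - w) (by simp [BinOp.eval, h19]) (by omega) ?_
  generalize hp : g - w = p at *
  refine .op (h + w) (by simp [BinOp.eval, h17]) (by omega) ?_
  generalize hq : h + w = q at *
  have l1 := PartialDom.digits_lt (show p < groupSize n by omega) (show q < groupSize n by omega)
  have l2 := PartialDom.digits_lt l1 hy
  have l3 : (p * groupSize n + q) * 1 ≤ (p * groupSize n + q) * (d + 3) := by gcongr; omega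
  refine .op (p * groupSize n) (by simp [BinOp.eval, he.group]) (by omega) ?_
  refine .op (p * groupSize n + q) (by simp [BinOp.eval]) (by omega) ?_
  generalize p * groupSize n + q = u1 at *
  refine .op (u1 * (d + 3)) (by simp [BinOp.eval, he.extDim]) (by omega) ?_
  refine .op (u1 * (d + 3) + y) (by simp [BinOp.eval, h16]) (by omega) ?_
  generalize u1 * (d + 3) + y = u2 at *
  refine .op (u2 * 3) (by simp [BinOp.eval, he.three]) (by omega) ?_
  refine .op (if b < family n x then 1 else 0) (by simp [BinOp.eval, h20, h21])
    (by split_ifs <;> omega) ?_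
  generalize (if b < family n x then 1 else 0) = c at *
  refine .op (u2 * 3 + c) (by simp [BinOp.eval]) (by omega) ?_
  refine .op (u2 * 3 + c + b) (by simp [BinOp.eval, h21]) (by omega) ?_
  refine .op (u2 * 3 + c + b + b) (by simp [BinOp.eval, h21]) (by omega) ?_
  refine .op v (by simp [BinOp.eval, he.vectors, hgd]) (by omega) ?_
  refine .op (2 * e) (by simp [BinOp.eval, h14, two_mul]) (by omega) ?_
  refine .op (2 * e + 2) (by simp [BinOp.eval, he.two]) (by omega) ?_
  refine .store (2 * e + 2) x (by simp) (by simp [h18]) ?_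
  refine .op (2 * e + 3) (by simp [BinOp.eval, he.one]) (by omega) ?_
  refine .store (2 * e + 3) v (by simp) (by simp) ?_
  refine .op (e + 1) (by simp [BinOp.eval, h14, he.one]) (by omega) ?_
  refine .op (if e + 1 < edgeCount n d then 1 else 0) (by simp [BinOp.eval, he.edges])
        (by split_ifs <;> omega) (.nil ⟨?_, by simp, by simp, ?_, ?_, ?_, ?_⟩)
  · repeat' first | with_reducible exact he | with_reducible apply Env.setMem |
      with_reducible apply Env.setReg | omega
  · repeat' first | with_reducible exact hm | with_reducible apply HasData.setMem |
      with_reducible apply HasData.setReg | omega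
  · simpa using hg.1
  · simpa using hg.2.1
  · intro i hi
    simp only [State.mem_setReg, State.mem_setMem]
    by_cases hie : i = e
    · subst hie
      rw [if_neg (by omega), if_pos rfl, if_pos rfl, hxe, hhe, hye]
      exact ⟨rfl, hgd'.symm⟩
    · rw [if_neg (by omega), if_neg (by omega), if_neg (by omega), if_neg (by omega)]
      exact hg.2.2 i (by omega)

theorem writeGraph_reaches (hW : 4 * edgeCount n d < W) (hn : 1 ≤ n) (hdata : ∀ i, data i ≤ 1)
    {s : State} (he : Env B n d s) (hm : HasData n d data s) :
    Reaches W (writeGraph B) s (60 * edgeCount n d) fun s' => Env B n d s' ∧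
      HasData n d data s' ∧ HasGraph n d data (edgeCount n d) s' := by
  have hV := vertices_le n d
  have hE := edgeCount_pos n d
  have hs4 := four_le_groupSize n
  have hss : 4 * 4 ≤ groupSize n * groupSize n := by gcongr
  have hstart : Reaches W (writeGraph B) s
      (1 + (edgeCount n d * (1 + 22 + 15 + 1) + 1) + 1 + 1 + 1 + 1 + 1 + 1 + 1 + 1) fun s' =>
      Env B n d s' ∧ HasData n d data s' ∧ HasGraph n d data (edgeCount n d) s' := by
    refine .const (by omega) ?_
    refine .op (groupSize n * groupSize n * (d + 3))
      (by simp [BinOp.eval, he.vectors, he.extDim]) (by omega) ?_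
    refine .op (groupSize n * groupSize n * (d + 3) * 3)
      (by simp [BinOp.eval, he.three]) (by omega) ?_
    refine .op (groupSize n * groupSize n + groupSize n * groupSize n * (d + 3) * 3)
      (by simp [BinOp.eval, he.vectors]) (by omega) ?_
    refine .store 0 (groupSize n * groupSize n + groupSize n * groupSize n * (d + 3) * 3)
      (by simp) (by simp) ?_
    refine .store 1 (edgeCount n d) (by simp [he.one]) (by simp [he.edges]) ?_
    refine .const (by omega) (.op 1 (by simp [BinOp.eval, he.edges, hE]) (by omega) ?_)
    refine .cons (l := []) ((Reaches.loop (T := 1 + 22 + 15) (N := edgeCount n d) (I := fun k s =>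
      Env B n d s ∧ s.reg (B + 14) = k ∧ s.reg (B + 15) = (if k < edgeCount n d then 1 else 0) ∧
      HasData n d data s ∧ HasGraph n d data k s) ?_ ?_ ?_).weaken le_rfl ?_)
    · rintro k s - ⟨-, -, h, -⟩
      rw [h]
      split_ifs <;> simp [*]
    · rintro k s hk ⟨he, h14, h15, hm, hg⟩
      refine .cons ((decodeEdge_reaches hW he hn hm hk h14).weaken le_rfl ?_)
      rintro s' ⟨he', hmem, g1, g2, g3, g4, g5, g6, g7⟩
      unfold HasData HasGraph at *
      rw [← hmem] at hm hg
      exact .cons ((writeEdge_reaches hW hdata he' hm hk hg g1 g2 g3 g4 g5 g6 g7).weaken le_rfl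
        fun _ h => .nil h)
    · refine ⟨?_, by simp, by simp [hE], ?_, by simp, by simp, ?_⟩
      · repeat' first | with_reducible exact he | with_reducible apply Env.setMem |
          with_reducible apply Env.setReg | omega
      · repeat' first | with_reducible exact hm | with_reducible apply HasData.setMem |
          with_reducible apply HasData.setReg | omega
      · intro e he
        omega
    · rintro s' ⟨he, -, -, h1, h2⟩
      exact .nil ⟨he, h1, h2⟩
  exact hstart.weaken (by omega) fun _ h => h

end Correct
end OV

namespace OV

/-! ### The encoded instance and its padded list of vectors -/

section Input

variable {n d : ℕ} (A B : Fin n → Fin d → Bool)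

/-- The `i`-th entry of the two families, row by row. -/
def entry (i : ℕ) : ℕ := (encodeVectors A ++ encodeVectors B).getD i 0

theorem digits_div_mod {k a r : ℕ} (hr : r < k) : (a * k + r) / k = a ∧ (a * k + r) % k = r := by
  rw [mul_comm, Nat.mul_add_div (by omega), Nat.div_eq_of_lt hr, Nat.mul_add_mod,
    Nat.mod_eq_of_lt hr]
  exact ⟨rfl, rfl⟩

theorem encodeVectors_eq : encodeVectors A =
    List.ofFn fun k : Fin (n * d) => (A k.divNat k.modNat).toNat := by
  rw [encodeVectors, List.ofFn_mul]
  refine congrArg List.flatten (congrArg List.ofFn (funext fun i => congrArg List.ofFn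
    (funext fun y => congrArg Bool.toNat (congrArg₂ A (Fin.ext ?_) (Fin.ext ?_)))))
  · exact (digits_div_mod y.2).1.symm
  · exact (digits_div_mod y.2).2.symm

theorem length_encodeVectors : (encodeVectors A).length = n * d := by
  rw [encodeVectors_eq, List.length_ofFn]

theorem getD_encodeVectors (i : Fin n) (y : Fin d) :
    (encodeVectors A).getD (i * d + y) 0 = (A i y).toNat := by
  have h : (i : ℕ) * d + y < n * d := PartialDom.digits_lt i.2 y.2
  rw [List.getD_eq_getElem _ _ (by rwa [length_encodeVectors])]
  simp only [encodeVectors_eq, List.getElem_ofFn]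
  exact congrArg Bool.toNat (congrArg₂ A (Fin.ext (digits_div_mod y.2).1)
    (Fin.ext (digits_div_mod y.2).2))

theorem entry_left (i : Fin n) (y : Fin d) : entry A B (i * d + y) = (A i y).toNat := by
  have h : (i : ℕ) * d + y < n * d := PartialDom.digits_lt i.2 y.2
  rw [entry, List.getD_append _ _ _ _ (by rwa [length_encodeVectors]), getD_encodeVectors]

theorem entry_right (j : Fin n) (y : Fin d) : entry A B ((n + j) * d + y) = (B j y).toNat := by
  rw [entry, List.getD_append_right _ _ _ _ (by rw [length_encodeVectors]; nlinarith),
    length_encodeVectors, show (n + j) * d + y - n * d = j * d + y by rw [add_mul]; omega,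
    getD_encodeVectors]

theorem entry_le (i : ℕ) : entry A B i ≤ 1 := by
  rw [entry]
  obtain h | h := lt_or_ge i (encodeVectors A ++ encodeVectors B).length
  · rw [List.getD_eq_getElem _ _ h]
    have := List.getElem_mem h
    generalize (encodeVectors A ++ encodeVectors B)[i] = v at this
    simp only [encodeVectors_eq, List.mem_append, List.mem_ofFn] at this
    obtain ⟨k, rfl⟩ | ⟨k, rfl⟩ := this
    all_goals exact Bool.toNat_le _
  · rw [List.getD_eq_default _ _ h]
    omega

theorem initState_encode_mem (i : ℕ) :
    (initState (encode A B)).mem (i + 2) = if i < 2 * n * d then entry A B i else 0 := by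
  simp only [initState, encode, List.getD_cons_succ]
  split_ifs with h
  · rfl
  · rw [List.getD_eq_default]
    rw [List.length_append, length_encodeVectors, length_encodeVectors]
    linarith

theorem add_four_le_inputSize : n + 4 ≤ inputSize (encode A B) ∧ d + 4 ≤ inputSize (encode A B) := by
  have h1 : n ≤ (encode A B).foldr max 0 := by simp [encode]
  have h2 : d ≤ (encode A B).foldr max 0 := by simp [encode]
  have h3 : 2 ≤ (encode A B).length := by simp [encode]
  unfold inputSize
  omega

/-- Two copies of a vector of the same family have a common `1`. -/
theorem exists_common_bit {data : ℕ → ℕ} {x x' : ℕ} (h : family n x = family n x') :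
    ∃ y < d + 3, extBit n d data x y = 1 ∧ extBit n d data x' y = 1 := by
  have h1 := family_le n x
  obtain h0 | h0 : family n x = 1 ∨ family n x = 0 := by omega
  -- Coordinate `d` is `1` exactly on the second family, the coordinates after it exactly on the
  -- first.
  · exact ⟨d, by omega, by simp [extBit, h0], by simp [extBit, ← h, h0]⟩
  · exact ⟨d + 1, by omega, by simp [extBit, h0], by simp [extBit, ← h, h0]⟩

/-- Vectors of different families are complementary on the additional coordinates, so only the
original ones matter; vectors of the same family never qualify, by `exists_common_bit`. Padding
reduces indices modulo `2 n` and so only repeats existing vectors. -/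
theorem hasOrthogonalPair_iff (hn : 1 ≤ n) : HasOrthogonalPair A B ↔
    ∃ x < groupSize n * groupSize n, ∃ x' < groupSize n * groupSize n, ∀ y < d + 3,
      ¬ (extBit n d (entry A B) x y = 1 ∧ extBit n d (entry A B) x' y = 1) := by
  have hs := le_groupSize_sq n
  have hzero : ∀ p q : Bool, p.toNat * q.toNat = 0 ↔ ¬ (p.toNat = 1 ∧ q.toNat = 1) := by decide
  unfold HasOrthogonalPair
  simp only [Finset.sum_eq_zero_iff, Finset.mem_univ, true_implies, hzero]
  constructor
  · rintro ⟨i, j, h⟩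
    refine ⟨i, by omega, n + j, by omega, fun y hy => ?_⟩
    have e1 : (i : ℕ) % (2 * n) = i := Nat.mod_eq_of_lt (by omega)
    have e2 : (n + j) % (2 * n) = n + j := Nat.mod_eq_of_lt (by omega)
    have f1 : family n i = 0 := by rw [family, e1, Nat.div_eq_of_lt i.2]
    have f2 : family n (n + j) = 1 := by
      rw [family, e2, Nat.add_div_left _ hn, Nat.div_eq_of_lt j.2]
    by_cases hyd : y < d
    · have := h ⟨y, hyd⟩
      rw [← entry_left A B, ← entry_right A B] at this
      simpa [extBit, hyd, e1, e2] using this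
    · by_cases hyd' : y = d
      · simp [extBit, f1, hyd']
      · simp [extBit, hyd, f2, hyd']
  · have key : ∀ x x', family n x = 0 → family n x' = 1 → (∀ y < d + 3,
        ¬ (extBit n d (entry A B) x y = 1 ∧ extBit n d (entry A B) x' y = 1)) →
        ∃ i j : Fin n, ∀ y, ¬ ((A i y).toNat = 1 ∧ (B j y).toNat = 1) := by
      intro x x' hx hx' h
      unfold family at hx hx'
      have l1 : x % (2 * n) < n := by
        by_contra hc
        have := Nat.div_pos (not_lt.1 hc) hn
        omega
      have l2 : n ≤ x' % (2 * n) := by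
        by_contra hc
        rw [Nat.div_eq_of_lt (not_le.1 hc)] at hx'
        omega
      have l3 : x' % (2 * n) < 2 * n := Nat.mod_lt _ (by omega)
      refine ⟨⟨x % (2 * n), l1⟩, ⟨x' % (2 * n) - n, by omega⟩, fun y => ?_⟩
      have := h y (by omega)
      rw [← entry_left A B, ← entry_right A B]
      simpa [extBit, Nat.add_sub_cancel' l2] using this
    rintro ⟨x, -, x', -, h⟩
    have h1 := family_le n x
    have h2 := family_le n x'
    have hne : family n x ≠ family n x' := fun he => by
      obtain ⟨y, hy, hb⟩ := exists_common_bit (d := d) (data := entry A B) he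
      exact h y hy hb
    obtain hf | hf : family n x = 0 ∧ family n x' = 1 ∨ family n x = 1 ∧ family n x' = 0 := by omega
    · exact key x x' hf.1 hf.2 h
    · exact key x' x hf.2 hf.1 fun y hy hb => h y hy hb.symm

end Input

/-! ### Memory image of the graph, word length, and the composed program -/

theorem getD_flatMap_pair {α : Type*} (l : List α) (f g : α → ℕ) (k : ℕ) (hk : k < l.length) :
    (l.flatMap fun e => [f e, g e]).getD (2 * k) 0 = f l[k] ∧
      (l.flatMap fun e => [f e, g e]).getD (2 * k + 1) 0 = g l[k] := by
  induction l generalizing k with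
  | nil => simp at hk
  | cons a l ih =>
    cases k with
    | zero => simp
    | succ k =>
      have := ih k (by simpa using hk)
      simpa [Nat.mul_add] using this

theorem length_flatMap_pair {α : Type*} (l : List α) (f g : α → ℕ) :
    (l.flatMap fun e => [f e, g e]).length = 2 * l.length := by
  induction l with
  | nil => rfl
  | cons a l ih => simp [ih]; omega

theorem foldr_max_le {l : List ℕ} {M : ℕ} (h : ∀ v ∈ l, v ≤ M) : l.foldr max 0 ≤ M := by
  induction l with
  | nil => simp
  | cons a l ih =>
    simp only [List.mem_cons, forall_eq_or_imp] at h
    exact max_le h.1 (ih h.2)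

/-- Either `s = 4`, or minimality gives `(s - 1)² < 2 n`. -/
theorem groupSize_sq_le {n : ℕ} (hn : 1 ≤ n) : groupSize n * groupSize n ≤ 16 * n := by
  have h4 := four_le_groupSize n
  obtain h | h := h4.eq_or_lt
  · rw [← h]
    omega
  · obtain ⟨k, hk⟩ : ∃ k, groupSize n = k + 1 := ⟨groupSize n - 1, by omega⟩
    have := groupSize_min (n := n) (k := k) (by omega) (by omega)
    rw [hk]
    nlinarith

/-- A polynomial bound in the input size, so that numbers of the size of the graph occupy `O(log N)`
bits. -/
theorem edgeCount_lt {n d N : ℕ} (hn : 1 ≤ n) (h : n + 4 ≤ N) (h' : d + 4 ≤ N) :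
    4 * edgeCount n d < N ^ 8 := by
  have h1 : groupSize n ≤ 4 * N := by
    have := groupSize_sq_le hn
    nlinarith
  calc 4 * edgeCount n d ≤ 4 * ((4 * N) * (4 * N) * (4 * N) * (d + 3)) := by
        unfold edgeCount
        gcongr
    _ < 4 * ((4 * N) * (4 * N) * (4 * N) * N) := by
        have : 0 < N := by omega
        gcongr
        omega
    _ = 4 ^ 4 * N ^ 4 := by ring
    _ ≤ N ^ 4 * N ^ 4 := by
        gcongr
        omega
    _ = N ^ 8 := by ring

/-- The edge list of the graph that the reduction writes into the memory. -/
def reductionEdges {n d : ℕ} (A B : Fin n → Fin d → Bool) :=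
  PartialDom.gadgetEdges (groupSize n) (d + 3) (extBit n d (entry A B)) (family n)
    (extBit_le (entry_le A B)) (family_le n)

theorem length_reductionEdges {n d : ℕ} (A B : Fin n → Fin d → Bool) :
    (reductionEdges A B).length = edgeCount n d := by
  rw [reductionEdges, PartialDom.gadgetEdges, List.length_ofFn, edgeCount]

theorem inputSize_reductionEdges {n d : ℕ} (A B : Fin n → Fin d → Bool) :
    inputSize (PartialDom.encode (reductionEdges A B)) ≤ 4 * edgeCount n d := by
  have hV := vertices_le n d
  have hs := four_le_groupSize n
  have hs2 : 4 * 4 ≤ groupSize n * groupSize n := by gcongr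
  have h1 : (PartialDom.encode (reductionEdges A B)).length = 2 * edgeCount n d + 2 := by
    simp only [PartialDom.encode, List.length_cons, length_flatMap_pair, length_reductionEdges]
  have h2 : (PartialDom.encode (reductionEdges A B)).foldr max 0 ≤ edgeCount n d := by
    apply foldr_max_le
    intro v hv
    simp only [PartialDom.encode, List.mem_cons, List.mem_flatMap, length_reductionEdges,
      List.not_mem_nil, or_false] at hv
    obtain rfl | rfl | ⟨e, -, rfl | rfl⟩ := hv
    · exact hV
    · exact le_rfl
    · exact e.1.2.le.trans hV
    · exact e.2.2.le.trans hV
  unfold inputSize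
  omega

/-- The whole memory has to agree, including the empty cells, because the given program may read
anywhere. -/
theorem initState_reductionEdges_mem {n d : ℕ} (A B : Fin n → Fin d → Bool) {s : State}
    (hg : HasGraph n d (entry A B) (edgeCount n d) s)
    (h0 : ∀ i, s.mem (2 * edgeCount n d + 2 + i) = 0) :
    s.mem = (initState (PartialDom.encode (reductionEdges A B))).mem := by
  obtain ⟨g0, g1, g2⟩ := hg
  have hlen := length_reductionEdges A B
  funext a
  simp only [initState, PartialDom.encode]
  obtain rfl | rfl | ⟨i, rfl⟩ : a = 0 ∨ a = 1 ∨ ∃ i, a = i + 2 := by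
    by_cases ha : a < 2
    · omega
    · exact .inr (.inr ⟨a - 2, by omega⟩)
  · simp [g0]
  · simp [g1, hlen]
  · simp only [List.getD_cons_succ]
    by_cases hi : i < 2 * edgeCount n d
    · obtain ⟨k, hk⟩ : ∃ k, i = 2 * k ∨ i = 2 * k + 1 := ⟨i / 2, by omega⟩
      have hk' : k < edgeCount n d := by omega
      obtain ⟨e1, e2⟩ := getD_flatMap_pair (reductionEdges A B) (fun e => (e.1 : ℕ))
        (fun e => (e.2 : ℕ)) k (by omega)
      obtain rfl | rfl := hk
      · rw [e1, (g2 k hk').1]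
        simp [reductionEdges, PartialDom.gadgetEdges]
      · rw [e2, (g2 k hk').2]
        simp [reductionEdges, PartialDom.gadgetEdges]
    · rw [List.getD_eq_default _ _ (by rw [length_flatMap_pair, hlen]; omega)]
      have := h0 (i - 2 * edgeCount n d)
      rwa [show 2 * edgeCount n d + 2 + (i - 2 * edgeCount n d) = i + 2 by omega] at this

open Classical in
theorem reduction_outputsWithin {P : Cmd} {T : ℕ → ℝ} {c : ℕ}
    (hP : ∀ (n : ℕ) (G : SimpleGraph (Fin n)) (E : List (Fin n × Fin n)) (t : ℕ),
      1 ≤ n → n ≤ G.edgeSet.ncard → PartialDom.IsEdgeList G E → PartialDom.IsOptimum G t →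
        P.OutputsWithin c (PartialDom.encode E) t (T G.edgeSet.ncard))
    {n d : ℕ} (A B : Fin n → Fin d → Bool) (hn : 1 ≤ n) :
    (reduction P).OutputsWithin (8 * (c + 1)) (encode A B) (if HasOrthogonalPair A B then 1 else 0)
      (100 * edgeCount n d + T (edgeCount n d)) := by
  have hV := vertices_le n d
  have hE := edgeCount_pos n d
  have hs := four_le_groupSize n
  have hs2 : 4 * 4 ≤ groupSize n * groupSize n := by gcongr
  obtain ⟨hN, hN'⟩ := add_four_le_inputSize A B
  have hm := edgeCount_lt hn hN hN'
  set N := inputSize (encode A B)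
  have hN8 : 1 ≤ N ^ 8 := by omega
  -- The exponent `8 * c` suffices for the given program; the summand `1` leaves room for the
  -- arithmetic of the reduction even if `c = 0`.
  have hW : 4 * edgeCount n d < N ^ (8 * (c + 1)) := by
    rw [pow_mul]
    exact hm.trans_le (le_self_pow₀ hN8 (by omega))
  have hWP : inputSize (PartialDom.encode (reductionEdges A B)) ^ c ≤ N ^ (8 * (c + 1)) := by
    rw [pow_mul]
    exact (Nat.pow_le_pow_left ((inputSize_reductionEdges A B).trans hm.le) c).trans
      (Nat.pow_le_pow_right hN8 (by omega))
  have hlist := PartialDom.isEdgeList_gadgetEdges (hb := extBit_le (n := n) (d := d) (entry_le A B))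
    (hσ := family_le n) (s := groupSize n) (D := d + 3)
  have hcard := hlist.ncard_edgeSet.trans (length_reductionEdges A B)
  obtain ⟨t, ht⟩ : ∃ t, PartialDom.IsOptimum (PartialDom.gadgetGraph (groupSize n) (d + 3)
      (extBit n d (entry A B)) (family n) (extBit_le (entry_le A B)) (family_le n)) t := by
    have : Nonempty (Fin (groupSize n * groupSize n +
      groupSize n * groupSize n * (d + 3) * 3)) := ⟨⟨0, by omega⟩⟩
    exact PartialDom.exists_optimum _
  have hiff := PartialDom.gadgetGraph_optimum (by omega) (by omega)
    (fun x x' h => exists_common_bit h) ht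
  rw [← hasOrthogonalPair_iff A B hn] at hiff
  obtain ⟨sP, tP, eP, hsP, htP⟩ := hP _ _ _ t (by omega) (by omega) hlist ht
  rw [hcard] at htP
  have hrun : Reaches (N ^ (8 * (c + 1))) (reduction P) (initState (encode A B))
      (1 + 1 + tP + 8 * edgeCount n d + 60 * edgeCount n d + 8 * edgeCount n d + 4 * edgeCount n d)
      fun s' => s'.reg 0 = if HasOrthogonalPair A B then 1 else 0 := by
    refine .cons ((setup_reaches (n := n) (d := d) hW (fun _ => rfl) (by simp [initState, encode])
      (by simp [initState, encode])).weaken le_rfl ?_)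
    rintro s₁ ⟨he₁, hm₁⟩
    refine .cons ((copyData_reaches (data := entry A B) hW he₁ fun i => ?_).weaken le_rfl ?_)
    · rw [hm₁, initState_encode_mem]
    rintro s₂ ⟨he₂, hd₂⟩
    refine .cons ((writeGraph_reaches hW hn (entry_le A B) he₂ hd₂).weaken le_rfl ?_)
    rintro s₃ ⟨he₃, hd₃, hg₃⟩
    refine .cons ((clearData_reaches hW he₃ hd₃).weaken le_rfl ?_)
    rintro s₄ ⟨he₄, hz, hsame⟩
    have hmem : s₄.mem = (initState (PartialDom.encode (reductionEdges A B))).mem := by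
      refine initState_reductionEdges_mem A B ⟨?_, ?_, fun e he => ⟨?_, ?_⟩⟩ hz
      · rw [hsame _ (by omega), hg₃.1]
      · rw [hsame _ (by omega), hg₃.2.1]
      · rw [hsame _ (by omega), (hg₃.2.2 e he).1]
      · rw [hsame _ (by omega), (hg₃.2.2 e he).2]
    -- The parameters sit in registers that `P` does not touch, so the target value survives the
    -- run. The offset `P.regBound + 1` keeps the output register `0` below them in all cases.
    obtain ⟨s₅, e₅, ha, hr⟩ := (eP.mono hWP).frame (Nat.le_succ P.regBound) s₄
      ⟨fun r hr => he₄.low r hr, hmem⟩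
    refine .cons ⟨s₅, tP, e₅, le_rfl, ?_⟩
    have h0 : s₅.reg 0 = t := (ha.1 0 (by omega)).trans hsP
    have h13 : s₅.reg (P.regBound + 1 + 13) = 2 * (groupSize n * (d + 3) + 1) :=
      (hr _ (by omega)).trans he₄.target
    refine .op (if HasOrthogonalPair A B then 1 else 0) ?_ (by split_ifs <;> omega) (.nil (by simp))
    simp only [BinOp.eval, h0, h13, hiff]
  obtain ⟨s', t', e', ht', hq⟩ := hrun
  refine ⟨s', t', e', hq, ?_⟩
  have : (t' : ℝ) ≤ ((100 * edgeCount n d + tP : ℕ) : ℝ) := by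
    exact_mod_cast ht'.trans (by omega)
  push_cast at this
  linarith

/-! ### Asymptotic estimates -/

/-- Dimensions that grow as the square of the logarithm. -/
noncomputable def logSq (n : ℕ) : ℕ := ⌈Real.log n ^ 2⌉₊

theorem log_isLittleO_logSq :
    (fun n : ℕ => Real.log n) =o[Filter.atTop] fun n : ℕ => (logSq n : ℝ) := by
  have hlog : Filter.Tendsto (fun n : ℕ => Real.log n) Filter.atTop Filter.atTop :=
    Real.tendsto_log_atTop.comp tendsto_natCast_atTop_atTop
  refine Asymptotics.isLittleO_iff.2 fun c hc => ?_
  filter_upwards [hlog.eventually_ge_atTop (1 / c), hlog.eventually_ge_atTop 0] with n h1 h0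
  have h2 : Real.log n ^ 2 ≤ logSq n := Nat.le_ceil _
  rw [Real.norm_of_nonneg h0, Real.norm_of_nonneg (Nat.cast_nonneg _)]
  calc Real.log n = c * (1 / c * Real.log n) := by field_simp
    _ ≤ c * (Real.log n * Real.log n) := by gcongr
    _ = c * Real.log n ^ 2 := by ring
    _ ≤ c * logSq n := by gcongr

/-- Square `log n ≤ n^(δ/2) / (δ/2)`; the remaining `4` absorbs the rounding and the three
additional coordinates. -/
theorem logSq_add_le {δ : ℝ} (hδ : 0 < δ) {n : ℕ} (hn : 1 ≤ n) :
    (logSq n : ℝ) + 3 ≤ (4 / δ ^ 2 + 4) * (n : ℝ) ^ δ := by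
  have hn' : (1 : ℝ) ≤ n := by exact_mod_cast hn
  have h1 : Real.log n ≤ (n : ℝ) ^ (δ / 2) / (δ / 2) :=
    Real.log_le_rpow_div (by linarith) (by linarith)
  have h2 : (logSq n : ℝ) ≤ Real.log n ^ 2 + 1 := (Nat.ceil_lt_add_one (sq_nonneg _)).le
  have h3 : 0 ≤ Real.log n := Real.log_nonneg hn'
  have h4 : (1 : ℝ) ≤ (n : ℝ) ^ δ := Real.one_le_rpow hn' hδ.le
  have h5 : Real.log n ^ 2 ≤ 4 / δ ^ 2 * (n : ℝ) ^ δ := by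
    calc Real.log n ^ 2 ≤ ((n : ℝ) ^ (δ / 2) / (δ / 2)) ^ 2 := by gcongr
      _ = 4 / δ ^ 2 * ((n : ℝ) ^ (δ / 2)) ^ (2 : ℕ) := by field_simp; ring
      _ = 4 / δ ^ 2 * (n : ℝ) ^ δ := by
        rw [← Real.rpow_mul_natCast (by linarith)]
        congr 2
        push_cast
        ring
  linarith

theorem edgeCount_le {n d : ℕ} (hn : 1 ≤ n) :
    (edgeCount n d : ℝ) ≤ 64 * (n : ℝ) ^ (3 / 2 : ℝ) * (d + 3) := by
  have h1 : (groupSize n : ℝ) * groupSize n ≤ 16 * n := by exact_mod_cast groupSize_sq_le hn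
  have hn0 : (0 : ℝ) ≤ n := Nat.cast_nonneg n
  have h2 : (groupSize n : ℝ) ≤ 4 * (n : ℝ) ^ (1 / 2 : ℝ) := by
    rw [← Real.sqrt_eq_rpow]
    have h16 : √(16 * (n : ℝ)) = 4 * √n := by
      rw [Real.sqrt_mul (by norm_num), show (16 : ℝ) = 4 ^ 2 by norm_num,
        Real.sqrt_sq (by norm_num)]
    rw [← h16]
    exact Real.le_sqrt_of_sq_le (by rwa [sq])
  have h3 : (n : ℝ) ^ (3 / 2 : ℝ) = n * (n : ℝ) ^ (1 / 2 : ℝ) := by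
    rw [show (3 / 2 : ℝ) = 1 + 1 / 2 by norm_num, Real.rpow_add (by exact_mod_cast hn),
      Real.rpow_one]
  unfold edgeCount
  push_cast
  rw [h3]
  calc (groupSize n : ℝ) * groupSize n * groupSize n * (d + 3)
      ≤ 16 * n * (4 * (n : ℝ) ^ (1 / 2 : ℝ)) * (d + 3) := by gcongr
    _ = _ := by ring

end OV

theorem mainTheorem8 (ε : ℝ) (hε : 0 < ε)
    (h : ∃ (P : WordRAM.Cmd) (C : ℝ),
      PartialDom.Solves P fun m => C * (m : ℝ) ^ (4 / 3 - ε)) :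
    ¬ OV.Hypothesis := by
  obtain ⟨P, C, c, hP⟩ := h
  intro hOV
  -- Replacing `ε` by `η = min ε (1/3)` only weakens the time bound, and it keeps the exponent `4/3
  -- - η` at least `1`, so that the `O(m)` cost of the reduction is absorbed.
  have hα : 0 < min ε (1 / 3) := by positivity
  generalize hη : min ε (1 / 3) = η at hα
  have hη1 : η ≤ 1 / 3 := hη ▸ min_le_right _ _
  have hη2 : η ≤ ε := hη ▸ min_le_left _ _
  have hδ : 0 < η / 4 := by linarith
  set K : ℝ := 64 * (4 / (η / 4) ^ 2 + 4) with hK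
  have hK0 : 0 ≤ K := by positivity
  refine hOV ⟨η, OV.logSq, hα, OV.log_isLittleO_logSq, OV.reduction P,
    (100 + |C|) * K ^ (4 / 3 - η), 8 * (c + 1), fun n d A B hn hd => ?_⟩
  obtain ⟨s, t, he, hs, ht⟩ := OV.reduction_outputsWithin
    (T := fun m => C * (m : ℝ) ^ (4 / 3 - ε)) hP A B hn
  refine ⟨s, t, he, hs, ht.trans ?_⟩
  have hn' : (1 : ℝ) ≤ n := by exact_mod_cast hn
  have hm1 : (1 : ℝ) ≤ OV.edgeCount n d := by exact_mod_cast OV.edgeCount_pos n d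
  have hm : (OV.edgeCount n d : ℝ) ≤ K * (n : ℝ) ^ (3 / 2 + η / 4) := by
    have hd' : (d : ℝ) ≤ OV.logSq n := by exact_mod_cast hd
    calc (OV.edgeCount n d : ℝ) ≤ 64 * (n : ℝ) ^ (3 / 2 : ℝ) * (d + 3) := OV.edgeCount_le hn
      _ ≤ 64 * (n : ℝ) ^ (3 / 2 : ℝ) * ((4 / (η / 4) ^ 2 + 4) * (n : ℝ) ^ (η / 4)) := by
        gcongr
        linarith [OV.logSq_add_le hδ hn]
      _ = K * (n : ℝ) ^ (3 / 2 + η / 4) := by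
        rw [Real.rpow_add (by linarith), hK]
        ring
  calc 100 * (OV.edgeCount n d : ℝ) + C * (OV.edgeCount n d : ℝ) ^ (4 / 3 - ε)
      ≤ 100 * (OV.edgeCount n d : ℝ) ^ (4 / 3 - η)
        + |C| * (OV.edgeCount n d : ℝ) ^ (4 / 3 - η) := by
        gcongr
        · exact Real.self_le_rpow_of_one_le hm1 (by linarith)
        · exact le_abs_self C
    _ = (100 + |C|) * (OV.edgeCount n d : ℝ) ^ (4 / 3 - η) := by ring
    _ ≤ (100 + |C|) * (K * (n : ℝ) ^ (3 / 2 + η / 4)) ^ (4 / 3 - η) := by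
        gcongr
        linarith
    _ = (100 + |C|) * K ^ (4 / 3 - η) * (n : ℝ) ^ ((3 / 2 + η / 4) * (4 / 3 - η)) := by
        rw [Real.mul_rpow hK0 (by positivity), ← Real.rpow_mul (by linarith)]
        ring
    _ ≤ (100 + |C|) * K ^ (4 / 3 - η) * (n : ℝ) ^ (2 - η) := by
        gcongr
        -- The exponent is `(3/2 + η/4)(4/3 - η) = 2 - 7η/6 - η²/4`; the share `η/4` left to the
        -- dimension is small enough to save `η`.
        nlinarith
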